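/- Let $\mathbb{G}=(V,E)$ be a contextuality scenario: $V$ is a finite set and $E$ is a non-empty set of subsets of $V$ with $\bigcup_{e\in E}e=V$. A probabilistic model of $\mathbb{G}$ is a function $p:V\to[0,1]$ with $\sum_{x\in e}p(x)=1$ for all $e\in E$; let $\mathcal{G}(\mathbb{G})$ be the set of these, and assume $\mathcal{G}(\mathbb{G})\neq\emptyset$. A positive operator representation (POR) of $\mathbb{G}$ on a Hilbert space $H$ is a family $(A_x)_{x\in V}$ of positive operators in $\mathcal{B}(H)$ with $\sum_{x\in e}A_x=I$ for all $e\in E$; it is a projective representation (PR) if every $A_x$ is a projection. A POR $(A_x)_{x\in V}$ on $H$ is dilatable if there are a Hilbert space $K$, a PR $(P_x)_{x\in V}$ of $\mathbb{G}$ on $K$ and an isometry $W:H\to K$ with $A_x=W^*P_xW$ for all $x\in V$. The scenario $\mathbb{G}$ is dilating if each of its POR's is dilatable. Let $\mathcal{S}=\bigoplus_{e\in E}\ell^\infty_e$, where $\ell^\infty_e=\mathbb{C}^e$, let $$\tilde{\mathcal{J}}=\Big\{u=(u^e_x)_{e\in E,\,x\in e}\in\mathcal{S}:\ \sum_{e\in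 E}\sum_{x\in e}p(x)u^e_x=0\ \text{ for all } p\in\mathcal{G}(\mathbb{G})\Big\},$$ and let $\mathcal{S}_{\mathbb{G}}=\mathcal{S}/\tilde{\mathcal{J}}$ be the operator system quotient; thus a matrix $U\in M_n(\mathcal{S}_{\mathbb{G}})$ is positive if and only if, for every $\varepsilon>0$, $U+\varepsilon(I_n\otimes 1)$ has a positive lift in $M_n(\mathcal{S})$. For $x\in V$ let $a_x=|E|\,(\delta^e_x+\tilde{\mathcal{J}})\in\mathcal{S}_{\mathbb{G}}$, where $e$ is any edge containing $x$ and $\delta^e_x$ is the corresponding canonical basis vector of $\ell^\infty_e\subseteq\mathcal{S}$ (the choice of $e$ does not matter). Let $C^*(\mathbb{G})$ be the universal unital C*-algebra generated by projections $p_x$, $x\in V$, subject to the relations $\sum_{x\in e}p_x=1$, $e\in E$, and let $\mathcal{T}_{\mathbb{G}}=\mathrm{span}\{p_x:x\in V\}\subseteq C^*(\mathbb{G})$ with the inherited unit and matricial cones. Let $\Phi:\mathcal{S}_{\mathbb{G}}\to\mathcal{T}_{\mathbb{G}}$ be the (well-defined) linear map with $\Phi(a_x)=p_x$, $x\in V$.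 A complete order isomorphism is a completely positive linear bijection whose inverse is completely positive. Then: 1. $\mathbb{G}$ is dilating if and only if $\Phi:\mathcal{S}_{\mathbb{G}}\to\mathcal{T}_{\mathbb{G}}$ is a complete order isomorphism. 2. For every Hilbert space $H$: if $\phi:\mathcal{T}_{\mathbb{G}}\to\mathcal{B}(H)$ is a unital completely positive map, then $(\phi(p_x))_{x\in V}$ is a dilatable POR of $\mathbb{G}$; conversely, if $(A_x)_{x\in V}\subseteq\mathcal{B}(H)$ is a dilatable POR of $\mathbb{G}$, then there is a unique unital completely positive map $\phi:\mathcal{T}_{\mathbb{G}}\to\mathcal{B}(H)$ with $\phi(p_x)=A_x$ for all $x\in V$. -/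

import Mathlib

open scoped InnerProductSpace

universe u

noncomputable section

/-! ### Contextuality scenarios and their operator representations -/

/-- A contextuality scenario on a finite vertex set `V`: a non-empty set of subsets of `V`
(the edges, or measurements) whose union is `V`. -/
structure ContextualityScenario (V : Type u) [Fintype V] where
  edges : Finset (Finset V)
  edges_nonempty : edges.Nonempty
  covers : ∀ x : V, ∃ e ∈ edges, x ∈ e

namespace ContextualityScenario

section Representations

variable {V : Type u} [Fintype V] (G : ContextualityScenario V)

/-- The probabilistic models of `G`. -/
def probModels : Set (V → ℝ) :=
  {p | (∀ x, p x ∈ Set.Icc (0 : ℝ) 1) ∧ ∀ e ∈ G.edges, ∑ x ∈ e, p x = 1}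

/-- `G` is non-trivial if it admits a probabilistic model. -/
def IsNontrivial : Prop := G.probModels.Nonempty

variable {H : Type*} [NormedAddCommGroup H] [InnerProductSpace ℂ H] [CompleteSpace H]

/-- Positive operator representations (POR's) of `G` on the Hilbert space `H`. -/
structure IsPOR (A : V → H →L[ℂ] H) : Prop where
  pos : ∀ x, (A x).IsPositive
  sum_eq : ∀ e ∈ G.edges, ∑ x ∈ e, A x = 1

/-- Projective representations (PR's) of `G` on the Hilbert space `H`. -/
structure IsPR (P : V → H →L[ℂ] H) : Prop extends G.IsPOR P where
  proj : ∀ x, IsStarProjection (P x)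

end Representations

/-- `B` (on `K`) is a dilation of `A` (on `H`): for some isometry `W : H → K` we have
`A x = W* (B x) W` for all `x`. -/
def IsDilation {V H K : Type*} [NormedAddCommGroup H] [InnerProductSpace ℂ H] [CompleteSpace H]
    [NormedAddCommGroup K] [InnerProductSpace ℂ K] [CompleteSpace K]
    (A : V → H →L[ℂ] H) (B : V → K →L[ℂ] K) : Prop :=
  ∃ W : H →ₗᵢ[ℂ] K, ∀ x, A x =
    (ContinuousLinearMap.adjoint W.toContinuousLinearMap) ∘L (B x) ∘L W.toContinuousLinearMap

variable {V : Type u} [Fintype V] (G : ContextualityScenario V)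

/-- A dilatable POR: a POR that admits a dilation to a PR. -/
def IsDilatablePOR {H : Type u} [NormedAddCommGroup H] [InnerProductSpace ℂ H] [CompleteSpace H]
    (A : V → H →L[ℂ] H) : Prop :=
  G.IsPOR A ∧ ∃ (K : Type u) (_ : NormedAddCommGroup K) (_ : InnerProductSpace ℂ K)
    (_ : CompleteSpace K) (P : V → K →L[ℂ] K), G.IsPR P ∧ IsDilation A P

/-- `G` is dilating if every POR of `G` dilates to a PR of `G`. -/
def IsDilating : Prop :=
  ∀ (H : Type u) [NormedAddCommGroup H] [InnerProductSpace ℂ H] [CompleteSpace H]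
    (A : V → H →L[ℂ] H), G.IsPOR A → G.IsDilatablePOR A

/-! ### The free hypergraph C*-algebra `C*(G)`

`C*(G)` is the (Hausdorff) completion of the free complex *-algebra on self-adjoint generators
`x ∈ V` in the C*-seminorm `‖a‖ = sup ‖a(P)‖`, the supremum being over all PR's `P` of `G`. -/

/-- The free unital complex algebra on `V`, to be given the conjugate-linear involution fixing
the generators and the universal C*-seminorm of `G`. -/
def PreAlg (_G : ContextualityScenario V) : Type u := FreeAlgebra ℂ V

instance : Ring G.PreAlg := inferInstanceAs (Ring (FreeAlgebra ℂ V))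
instance : Algebra ℂ G.PreAlg := inferInstanceAs (Algebra ℂ (FreeAlgebra ℂ V))

/-- The free generators. -/
def gen (x : V) : G.PreAlg := FreeAlgebra.ι ℂ x

/-- The opposite algebra with conjugated scalars, the target of the involution. -/
def ConjOp : Type u := (G.PreAlg)ᵐᵒᵖ

instance : Ring G.ConjOp := inferInstanceAs (Ring (G.PreAlg)ᵐᵒᵖ)
instance : Algebra ℂ G.ConjOp :=
  RingHom.toAlgebra' ((algebraMap ℂ (G.PreAlg)ᵐᵒᵖ).comp (starRingEnd ℂ))
    (fun c x => Algebra.commutes (R := ℂ) (A := (G.PreAlg)ᵐᵒᵖ) (starRingEnd ℂ c) x)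

lemma preAlg_induction {motive : G.PreAlg → Prop}
    (h1 : ∀ c : ℂ, motive (algebraMap ℂ G.PreAlg c)) (h2 : ∀ x, motive (G.gen x))
    (h3 : ∀ a b, motive a → motive b → motive (a * b))
    (h4 : ∀ a b, motive a → motive b → motive (a + b)) (a : G.PreAlg) : motive a :=
  FreeAlgebra.induction ℂ V (motive := motive) h1 h2 h3 h4 a

/-- The involution as a homomorphism into the conjugate opposite algebra. -/
def starHom : G.PreAlg →ₐ[ℂ] G.ConjOp :=
  FreeAlgebra.lift ℂ (A := G.ConjOp) (fun x => MulOpposite.op (G.gen x))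

/-- The conjugate-linear, anti-multiplicative map fixing the generators. -/
def preStar (a : G.PreAlg) : G.PreAlg := MulOpposite.unop (α := G.PreAlg) (G.starHom a)

lemma preStar_gen (x : V) : G.preStar (G.gen x) = G.gen x :=
  congrArg (MulOpposite.unop (α := G.PreAlg))
    (FreeAlgebra.lift_ι_apply (A := G.ConjOp) (fun y => MulOpposite.op (G.gen y)) x)

lemma preStar_algebraMap (c : ℂ) :
    G.preStar (algebraMap ℂ G.PreAlg c) = algebraMap ℂ G.PreAlg (star c) :=
  congrArg (MulOpposite.unop (α := G.PreAlg)) (G.starHom.commutes c)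

lemma preStar_mul (a b : G.PreAlg) : G.preStar (a * b) = G.preStar b * G.preStar a :=
  congrArg (MulOpposite.unop (α := G.PreAlg)) (map_mul G.starHom a b)

lemma preStar_add (a b : G.PreAlg) : G.preStar (a + b) = G.preStar a + G.preStar b :=
  congrArg (MulOpposite.unop (α := G.PreAlg)) (map_add G.starHom a b)

instance : StarRing G.PreAlg where
  star := G.preStar
  star_involutive a := by
    refine G.preAlg_induction (motive := fun a => G.preStar (G.preStar a) = a) ?_ ?_ ?_ ?_ a
    · intro c; rw [preStar_algebraMap, preStar_algebraMap, star_star]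
    · intro x; rw [preStar_gen, preStar_gen]
    · intro a b ha hb; rw [preStar_mul, preStar_mul, ha, hb]
    · intro a b ha hb; rw [preStar_add, preStar_add, ha, hb]
  star_mul := G.preStar_mul
  star_add := G.preStar_add

lemma star_gen (x : V) : star (G.gen x) = G.gen x := G.preStar_gen x

lemma star_algebraMap' (c : ℂ) :
    star (algebraMap ℂ G.PreAlg c) = algebraMap ℂ G.PreAlg (star c) := G.preStar_algebraMap c

instance : StarModule ℂ G.PreAlg where
  star_smul c a := by
    rw [Algebra.smul_def, star_mul, star_algebraMap', ← Algebra.commutes, ← Algebra.smul_def]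

section Eval

variable {H : Type*} [NormedAddCommGroup H] [InnerProductSpace ℂ H]

/-- Evaluation of a free polynomial at a family of operators. -/
def eval (P : V → H →L[ℂ] H) : G.PreAlg →ₐ[ℂ] (H →L[ℂ] H) := FreeAlgebra.lift ℂ P

lemma eval_gen (P : V → H →L[ℂ] H) (x : V) : G.eval P (G.gen x) = P x :=
  FreeAlgebra.lift_ι_apply _ _

variable {G} in
lemma IsPR.eval_star [CompleteSpace H] {P : V → H →L[ℂ] H} (hP : G.IsPR P) (a : G.PreAlg) :
    G.eval P (star a) = star (G.eval P a) := by
  refine G.preAlg_induction (motive := fun a => G.eval P (star a) = star (G.eval P a))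
    ?_ ?_ ?_ ?_ a
  · intro c
    rw [star_algebraMap', AlgHom.commutes, AlgHom.commutes, algebraMap_star_comm]
  · intro x; rw [star_gen, eval_gen, (hP.proj x).isSelfAdjoint.star_eq]
  · intro a b ha hb; simp only [star_mul, map_mul, ha, hb]
  · intro a b ha hb; simp only [star_add, map_add, ha, hb]

end Eval

/-- The norms of `a` in the PR's of `G`. -/
def normSet (a : G.PreAlg) : Set ℝ :=
  {r | ∃ (H : Type u) (_ : NormedAddCommGroup H) (_ : InnerProductSpace ℂ H)
    (_ : CompleteSpace H) (P : V → H →L[ℂ] H), G.IsPR P ∧ r = ‖G.eval P a‖}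

lemma bddAbove_normSet (a : G.PreAlg) : BddAbove (G.normSet a) := by
  suffices h : ∃ C : ℝ, ∀ (H : Type u) [NormedAddCommGroup H] [InnerProductSpace ℂ H]
      [CompleteSpace H] (P : V → H →L[ℂ] H), G.IsPR P → ‖G.eval P a‖ ≤ C by
    obtain ⟨C, hC⟩ := h
    refine ⟨C, ?_⟩
    rintro r ⟨H, _, _, _, P, hP, rfl⟩
    exact hC H P hP
  refine G.preAlg_induction (motive := fun a => ∃ C : ℝ, ∀ (H : Type u) [NormedAddCommGroup H]
    [InnerProductSpace ℂ H] [CompleteSpace H] (P : V → H →L[ℂ] H), G.IsPR P →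
    ‖G.eval P a‖ ≤ C) ?_ ?_ ?_ ?_ a
  · intro c
    refine ⟨‖c‖, fun H _ _ _ P _ => ?_⟩
    rw [AlgHom.commutes, Algebra.algebraMap_eq_smul_one, norm_smul]
    exact mul_le_of_le_one_right (norm_nonneg _) ContinuousLinearMap.norm_id_le
  · intro x
    refine ⟨1, fun H _ _ _ P hP => ?_⟩
    rw [eval_gen]
    exact (hP.proj x).norm_le
  · rintro a b ⟨C, hC⟩ ⟨D, hD⟩
    refine ⟨C * D, fun H _ _ _ P hP => ?_⟩
    rw [map_mul]
    exact (norm_mul_le _ _).trans (mul_le_mul (hC H P hP) (hD H P hP) (norm_nonneg _)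
      ((norm_nonneg _).trans (hC H P hP)))
  · rintro a b ⟨C, hC⟩ ⟨D, hD⟩
    refine ⟨C + D, fun H _ _ _ P hP => ?_⟩
    rw [map_add]
    exact (norm_add_le _ _).trans (add_le_add (hC H P hP) (hD H P hP))

/-- The universal C*-seminorm of `G`. -/
def preNorm (a : G.PreAlg) : ℝ := sSup (G.normSet a)

lemma preNorm_nonneg (a : G.PreAlg) : 0 ≤ G.preNorm a := by
  apply Real.sSup_nonneg
  rintro r ⟨H, _, _, _, P, hP, rfl⟩
  exact norm_nonneg _

variable {G} in
lemma IsPR.norm_eval_le {H : Type u} [NormedAddCommGroup H] [InnerProductSpace ℂ H]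
    [CompleteSpace H] {P : V → H →L[ℂ] H} (hP : G.IsPR P) (a : G.PreAlg) :
    ‖G.eval P a‖ ≤ G.preNorm a :=
  le_csSup (G.bddAbove_normSet a) ⟨H, _, _, _, P, hP, rfl⟩

lemma preNorm_le {a : G.PreAlg} {C : ℝ} (hC : 0 ≤ C)
    (h : ∀ (H : Type u) [NormedAddCommGroup H] [InnerProductSpace ℂ H]
      [CompleteSpace H] (P : V → H →L[ℂ] H), G.IsPR P → ‖G.eval P a‖ ≤ C) :
    G.preNorm a ≤ C := by
  apply Real.sSup_le _ hC
  rintro r ⟨H, _, _, _, P, hP, rfl⟩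
  exact h H P hP

/-- The universal C*-seminorm as a ring seminorm. -/
def preRingSeminorm : RingSeminorm G.PreAlg where
  toFun := G.preNorm
  map_zero' := le_antisymm (G.preNorm_le le_rfl (fun H _ _ _ P _ => by simp)) (G.preNorm_nonneg _)
  add_le' a b := G.preNorm_le (add_nonneg (G.preNorm_nonneg _) (G.preNorm_nonneg _))
    (fun H _ _ _ P hP => by
      rw [map_add]
      exact (norm_add_le _ _).trans (add_le_add (hP.norm_eval_le a) (hP.norm_eval_le b)))
  neg' a := by simp [preNorm, normSet]
  mul_le' a b := G.preNorm_le (mul_nonneg (G.preNorm_nonneg _) (G.preNorm_nonneg _))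
    (fun H _ _ _ P hP => by
      rw [map_mul]
      exact (norm_mul_le _ _).trans (mul_le_mul (hP.norm_eval_le a) (hP.norm_eval_le b)
        (norm_nonneg _) (G.preNorm_nonneg _)))

instance : SeminormedRing G.PreAlg := G.preRingSeminorm.toSeminormedRing

lemma norm_def (a : G.PreAlg) : ‖a‖ = G.preNorm a := rfl

instance : NormedAlgebra ℂ G.PreAlg where
  norm_smul_le c a := G.preNorm_le (mul_nonneg (norm_nonneg _) (G.preNorm_nonneg _))
    (fun H _ _ _ P hP => by
      rw [map_smul, norm_smul]
      exact mul_le_mul_of_nonneg_left (hP.norm_eval_le a) (norm_nonneg _))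

lemma preNorm_star (a : G.PreAlg) : ‖star a‖ = ‖a‖ := by
  have key : ∀ b : G.PreAlg, ‖star b‖ ≤ ‖b‖ := fun b =>
    G.preNorm_le (G.preNorm_nonneg _) (fun H _ _ _ P hP => by
      rw [hP.eval_star, norm_star]
      exact hP.norm_eval_le b)
  refine le_antisymm (key a) ?_
  simpa using key (star a)

lemma preNorm_cstar (a : G.PreAlg) : ‖a‖ * ‖a‖ ≤ ‖star a * a‖ := by
  have h : ‖a‖ ≤ √‖star a * a‖ := G.preNorm_le (Real.sqrt_nonneg _) (fun H _ _ _ P hP => by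
    apply Real.le_sqrt_of_sq_le
    have := hP.norm_eval_le (star a * a)
    rw [map_mul, hP.eval_star, CStarRing.norm_star_mul_self, ← sq] at this
    exact this)
  calc ‖a‖ * ‖a‖ ≤ √‖star a * a‖ * √‖star a * a‖ :=
        mul_self_le_mul_self (norm_nonneg _) h
    _ = ‖star a * a‖ := Real.mul_self_sqrt (norm_nonneg _)

/-- The free hypergraph C*-algebra `C*(G)`. -/
def CStar : Type u := UniformSpace.Completion G.PreAlg

instance : NormedRing G.CStar := inferInstanceAs (NormedRing (UniformSpace.Completion G.PreAlg))
instance : CompleteSpace G.CStar :=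
  inferInstanceAs (CompleteSpace (UniformSpace.Completion G.PreAlg))

instance : NormedAlgebra ℂ G.CStar where
  toAlgebra := inferInstanceAs (Algebra ℂ (UniformSpace.Completion G.PreAlg))
  norm_smul_le c a := by
    have h : ∀ (c : ℂ) (a : UniformSpace.Completion G.PreAlg), ‖c • a‖ ≤ ‖c‖ * ‖a‖ :=
      fun c a => (norm_smul c a).le
    exact h c a

/-- The canonical map of the free algebra into `C*(G)`. -/
def toCStar : G.PreAlg →ₐ[ℂ] G.CStar where
  toFun a := (a : UniformSpace.Completion G.PreAlg)
  map_one' := UniformSpace.Completion.coe_one _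
  map_mul' := UniformSpace.Completion.coe_mul
  map_zero' := UniformSpace.Completion.coe_zero
  map_add' := UniformSpace.Completion.coe_add
  commutes' _ := rfl

lemma norm_toCStar (a : G.PreAlg) : ‖G.toCStar a‖ = ‖a‖ := UniformSpace.Completion.norm_coe a

lemma denseRange_toCStar : DenseRange G.toCStar := UniformSpace.Completion.denseRange_coe

lemma isometry_star : Isometry (star : G.PreAlg → G.PreAlg) :=
  Isometry.of_dist_eq (fun a b => by rw [dist_eq_norm, ← star_sub, preNorm_star, dist_eq_norm])

instance : Star G.CStar where
  star := UniformSpace.Completion.map (star : G.PreAlg → G.PreAlg)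

lemma star_toCStar (a : G.PreAlg) : star (G.toCStar a) = G.toCStar (star a) :=
  UniformSpace.Completion.map_coe G.isometry_star.uniformContinuous a

lemma continuous_star_cstar : Continuous (star : G.CStar → G.CStar) :=
  UniformSpace.Completion.continuous_map

instance : StarRing G.CStar where
  star_involutive a := by
    refine G.denseRange_toCStar.induction_on (p := fun a => star (star a) = a) a
      (isClosed_eq (G.continuous_star_cstar.comp G.continuous_star_cstar) continuous_id) ?_
    intro a; rw [star_toCStar, star_toCStar, star_star]
  star_mul a b := by
    refine G.denseRange_toCStar.induction_on₂ (p := fun a b => star (a * b) = star b * star a)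
      ?_ ?_ a b
    · exact isClosed_eq (G.continuous_star_cstar.comp continuous_mul)
        ((G.continuous_star_cstar.comp continuous_snd).mul
          (G.continuous_star_cstar.comp continuous_fst))
    · intro a b
      simp only [← map_mul, star_toCStar, star_mul]
  star_add a b := by
    refine G.denseRange_toCStar.induction_on₂ (p := fun a b => star (a + b) = star a + star b)
      ?_ ?_ a b
    · exact isClosed_eq (G.continuous_star_cstar.comp continuous_add)
        ((G.continuous_star_cstar.comp continuous_fst).add
          (G.continuous_star_cstar.comp continuous_snd))
    · intro a b
      simp only [← map_add, star_toCStar, star_add]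

instance : StarModule ℂ G.CStar where
  star_smul c a := by
    refine G.denseRange_toCStar.induction_on (p := fun a => star (c • a) = star c • star a) a
      (isClosed_eq (G.continuous_star_cstar.comp (continuous_const_smul c))
        (G.continuous_star_cstar.const_smul (star c))) ?_
    intro a
    simp only [← map_smul, star_toCStar, star_smul]

instance : CStarRing G.CStar where
  norm_mul_self_le a := by
    refine G.denseRange_toCStar.induction_on (p := fun a => ‖a‖ * ‖a‖ ≤ ‖star a * a‖) a
      (isClosed_le (continuous_norm.mul continuous_norm)
        (continuous_norm.comp (G.continuous_star_cstar.mul continuous_id))) ?_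
    intro a
    simp only [star_toCStar, ← map_mul, norm_toCStar]
    exact G.preNorm_cstar a

instance : CStarAlgebra G.CStar where

/-- The canonical generators `p_x` of `C*(G)`. -/
def projGen (x : V) : G.CStar := G.toCStar (G.gen x)

/-- An element of the free algebra that vanishes in every PR is zero in `C*(G)`. -/
lemma toCStar_eq_zero {a : G.PreAlg}
    (h : ∀ (H : Type u) [NormedAddCommGroup H] [InnerProductSpace ℂ H]
      [CompleteSpace H] (P : V → H →L[ℂ] H), G.IsPR P → G.eval P a = 0) : G.toCStar a = 0 := by
  rw [← norm_le_zero_iff, norm_toCStar]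
  exact G.preNorm_le le_rfl (fun H _ _ _ P hP => by rw [h H P hP, norm_zero])

lemma isStarProjection_projGen (x : V) : IsStarProjection (G.projGen x) where
  isIdempotentElem := by
    have := G.toCStar_eq_zero (a := G.gen x * G.gen x - G.gen x) (fun H _ _ _ P hP => by
      rw [map_sub, map_mul, eval_gen, (hP.proj x).isIdempotentElem.eq, sub_self])
    rwa [map_sub, map_mul, sub_eq_zero] at this
  isSelfAdjoint := by
    rw [IsSelfAdjoint, projGen, star_toCStar, star_gen]

lemma sum_projGen {e : Finset V} (he : e ∈ G.edges) : ∑ x ∈ e, G.projGen x = 1 := by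
  have := G.toCStar_eq_zero (a := ∑ x ∈ e, G.gen x - 1) (fun H _ _ _ P hP => by
    rw [map_sub, map_sum, map_one, sub_eq_zero, ← hP.sum_eq e he]
    exact Finset.sum_congr rfl (fun x _ => G.eval_gen P x))
  rwa [map_sub, map_sum, map_one, sub_eq_zero] at this

/-! ### Matrix orders and complete positivity -/

/-- The positive elements of `M_n(A)` for a C*-algebra `A`: those of the form `B* B`. -/
def matPos (A : Type*) [Ring A] [StarRing A] (n : ℕ) : Set (Matrix (Fin n) (Fin n) A) :=
  {M | ∃ B : Matrix (Fin n) (Fin n) A, M = B.conjTranspose * B}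

/-- Complete positivity of a linear map with respect to given families of matricial cones. -/
def IsCP {S T : Type*} [AddCommGroup S] [Module ℂ S] [AddCommGroup T] [Module ℂ T]
    (C : ∀ n, Set (Matrix (Fin n) (Fin n) S)) (D : ∀ n, Set (Matrix (Fin n) (Fin n) T))
    (φ : S →ₗ[ℂ] T) : Prop :=
  ∀ n, ∀ M ∈ C n, M.map φ ∈ D n

/-- Complete order isomorphisms: completely positive bijections with completely positive
inverse. -/
def IsCompleteOrderIso {S T : Type*} [AddCommGroup S] [Module ℂ S] [AddCommGroup T] [Module ℂ T]
    (C : ∀ n, Set (Matrix (Fin n) (Fin n) S)) (D : ∀ n, Set (Matrix (Fin n) (Fin n) T))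
    (φ : S →ₗ[ℂ] T) : Prop :=
  IsCP C D φ ∧ ∃ ψ : T →ₗ[ℂ] S, ψ ∘ₗ φ = LinearMap.id ∧ φ ∘ₗ ψ = LinearMap.id ∧ IsCP D C ψ

/-! ### The operator system `T_G ⊆ C*(G)` -/

/-- The linear span of the generators of `C*(G)`. -/
def TSys : Submodule ℂ G.CStar := Submodule.span ℂ (Set.range G.projGen)

/-- The generators `p_x` as elements of `T_G`. -/
def tGen (x : V) : G.TSys := ⟨G.projGen x, Submodule.subset_span ⟨x, rfl⟩⟩

lemma one_mem_TSys : (1 : G.CStar) ∈ G.TSys := by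
  obtain ⟨e, he⟩ := G.edges_nonempty
  rw [← G.sum_projGen he]
  exact Submodule.sum_mem _ (fun x _ => (G.tGen x).2)

/-- The unit of `T_G`. -/
def tOne : G.TSys := ⟨1, G.one_mem_TSys⟩

/-- The matricial cones that `T_G` inherits from `C*(G)`. -/
def tCone (n : ℕ) : Set (Matrix (Fin n) (Fin n) G.TSys) :=
  {M | M.map Subtype.val ∈ matPos G.CStar n}

/-! ### The operator system `S_G` -/

/-- The C*-algebra `⊕_{e ∈ E} ℓ^∞_e`. -/
abbrev EdgeAlg : Type u := (e : G.edges) → (e.1 → ℂ)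

/-- The functional `u ↦ ⟨p, u⟩ = ∑_{e ∈ E} ∑_{x ∈ e} p(x) u_x^e`. -/
def pairing (p : V → ℝ) : G.EdgeAlg →ₗ[ℂ] ℂ where
  toFun u := ∑ e : G.edges, ∑ x : e.1, (p x : ℂ) * u e x
  map_add' u v := by simp [mul_add, Finset.sum_add_distrib]
  map_smul' c u := by simp [Finset.mul_sum, mul_left_comm]

/-- The kernel `{u : ⟨p, u⟩ = 0 for all probabilistic models p}`. -/
def edgeKernel : Submodule ℂ G.EdgeAlg := ⨅ p ∈ G.probModels, LinearMap.ker (G.pairing p)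

lemma mem_edgeKernel {u : G.EdgeAlg} :
    u ∈ G.edgeKernel ↔ ∀ p ∈ G.probModels, G.pairing p u = 0 := by
  simp [edgeKernel, Submodule.mem_iInf]

/-- The universal operator system `S_G` as a vector space. -/
abbrev SSys : Type u := G.EdgeAlg ⧸ G.edgeKernel

/-- The unit of `S_G`. -/
def sOne : G.SSys := G.edgeKernel.mkQ 1

/-- The matricial cones of the operator system quotient: `U ∈ M_n(S_G)` is positive if, for
every `ε > 0`, the element `U + ε 1` lifts to a positive matrix over `⊕_e ℓ^∞_e`. -/
def sCone (n : ℕ) : Set (Matrix (Fin n) (Fin n) G.SSys) :=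
  {U | ∀ ε : ℝ, 0 < ε → ∃ M ∈ matPos G.EdgeAlg n,
    M.map G.edgeKernel.mkQ = U + Matrix.diagonal (fun _ => (ε : ℂ) • G.sOne)}

open Classical in
/-- The element `δ_x^e` of `ℓ^∞_e ⊆ ⊕_f ℓ^∞_f`. -/
def edgeDelta (e : G.edges) (x : e.1) : G.EdgeAlg := Pi.single e (Pi.single x 1)

/-- The generators `a_x = |E| (δ_x^e + kernel)` of `S_G`, for any edge `e` containing `x`. -/
def sGen (x : V) : G.SSys :=
  (G.edges.card : ℂ) • G.edgeKernel.mkQ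
    (G.edgeDelta ⟨(G.covers x).choose, (G.covers x).choose_spec.1⟩
      ⟨x, (G.covers x).choose_spec.2⟩)

lemma pairing_edgeDelta (p : V → ℝ) (e : G.edges) (x : e.1) :
    G.pairing p (G.edgeDelta e x) = p x := by
  classical
  change ∑ f : G.edges, ∑ y : f.1, (p y : ℂ) * G.edgeDelta e x f y = p x
  rw [Finset.sum_eq_single e]
  · rw [Finset.sum_eq_single x]
    · simp [edgeDelta]
    · intro y _ hy; simp [edgeDelta, hy]
    · simp
  · intro f _ hf
    simp [edgeDelta, hf]
  · simp

/-- `a_x` does not depend on the edge used to define it. -/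
lemma sGen_eq (e : G.edges) (x : e.1) :
    G.sGen x = (G.edges.card : ℂ) • G.edgeKernel.mkQ (G.edgeDelta e x) := by
  unfold sGen
  congr 1
  rw [← sub_eq_zero, ← map_sub, Submodule.mkQ_apply, Submodule.Quotient.mk_eq_zero,
    mem_edgeKernel]
  intro p _
  rw [map_sub, pairing_edgeDelta, pairing_edgeDelta, sub_self]

/-! ### The canonical map `Φ : S_G → T_G` -/

/-- The map `⊕_e ℓ^∞_e → T_G`, `u ↦ |E|⁻¹ ∑_e ∑_{x ∈ e} u_x^e p_x`. -/
def preCanonicalMap : G.EdgeAlg →ₗ[ℂ] G.TSys where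
  toFun u := (G.edges.card : ℂ)⁻¹ • ∑ e : G.edges, ∑ x : e.1, u e x • G.tGen x
  map_add' u v := by simp [add_smul, Finset.sum_add_distrib]
  map_smul' c u := by simp [Finset.smul_sum, smul_smul, mul_left_comm]

lemma IsPOR.probModel {H : Type*} [NormedAddCommGroup H] [InnerProductSpace ℂ H]
    [CompleteSpace H] {G : ContextualityScenario V} {A : V → H →L[ℂ] H} (hA : G.IsPOR A)
    {ξ : H} (hξ : ‖ξ‖ = 1) : (fun x => (⟪A x ξ, ξ⟫_ℂ).re) ∈ G.probModels := by
  have hsum : ∀ e ∈ G.edges, ∑ x ∈ e, (⟪A x ξ, ξ⟫_ℂ).re = 1 := by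
    intro e he
    have h := congrArg (fun T : H →L[ℂ] H => ⟪T ξ, ξ⟫_ℂ) (hA.sum_eq e he)
    simp only [sum_apply, sum_inner] at h
    rw [← Complex.re_sum, h]
    simp [inner_self_eq_norm_sq_to_K, hξ]
  have hpos : ∀ x, 0 ≤ (⟪A x ξ, ξ⟫_ℂ).re := fun x => (hA.pos x).re_inner_nonneg_left ξ
  refine ⟨fun x => ⟨hpos x, ?_⟩, hsum⟩
  obtain ⟨e, he, hx⟩ := G.covers x
  rw [← hsum e he]
  exact Finset.single_le_sum (f := fun x => (⟪A x ξ, ξ⟫_ℂ).re) (fun y _ => hpos y) hx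

lemma IsPOR.sum_eq_zero {H : Type*} [NormedAddCommGroup H] [InnerProductSpace ℂ H]
    [CompleteSpace H] {G : ContextualityScenario V} {A : V → H →L[ℂ] H} (hA : G.IsPOR A)
    {u : G.EdgeAlg} (hu : u ∈ G.edgeKernel) :
    ∑ e : G.edges, ∑ x : e.1, u e x • A x = 0 := by
  set T : H →L[ℂ] H := ∑ e : G.edges, ∑ x : e.1, u e x • A x with hT
  have hunit : ∀ ξ : H, ‖ξ‖ = 1 → ⟪ξ, T ξ⟫_ℂ = 0 := by
    intro ξ hξ
    have h := (mem_edgeKernel G).1 hu _ (hA.probModel hξ)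
    change ∑ e : G.edges, ∑ x : e.1, ((⟪A x ξ, ξ⟫_ℂ).re : ℂ) * u e x = 0 at h
    rw [← h, hT]
    simp only [sum_apply, smul_apply, inner_sum, inner_smul_right]
    refine Finset.sum_congr rfl fun e _ => Finset.sum_congr rfl fun x _ => ?_
    have hs : ⟪ξ, A x ξ⟫_ℂ = ⟪A x ξ, ξ⟫_ℂ := ((hA.pos x).isSymmetric ξ ξ).symm
    have hr : ((⟪A x ξ, ξ⟫_ℂ).re : ℂ) = ⟪A x ξ, ξ⟫_ℂ := by
      apply Complex.conj_eq_iff_re.1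
      rw [inner_conj_symm, hs]
    rw [hr, hs, mul_comm]
  have hz : (T : H →ₗ[ℂ] H) = 0 := by
    rw [← inner_map_self_eq_zero]
    intro ξ
    by_cases h0 : ξ = 0
    · simp [h0]
    have hn : (‖ξ‖ : ℂ) ≠ 0 := by simpa using h0
    have h1 := hunit ((‖ξ‖ : ℂ)⁻¹ • ξ) (by
      rw [norm_smul, norm_inv, Complex.norm_real, norm_norm, inv_mul_cancel₀ (by simpa using h0)])
    rw [map_smul, inner_smul_left, inner_smul_right] at h1
    have h2 : ⟪ξ, T ξ⟫_ℂ = 0 := by simpa [hn, h0] using h1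
    rw [← inner_conj_symm]
    simpa using congrArg (starRingEnd ℂ) h2
  exact ContinuousLinearMap.ext fun ξ => LinearMap.congr_fun hz ξ

lemma edgeKernel_le : G.edgeKernel ≤ LinearMap.ker G.preCanonicalMap := by
  intro u hu
  rw [LinearMap.mem_ker]
  have h : G.toCStar (∑ e : G.edges, ∑ x : e.1, u e x • G.gen x) = 0 :=
    G.toCStar_eq_zero (fun H _ _ _ P hP => by
      simpa [map_sum, eval_gen] using hP.toIsPOR.sum_eq_zero hu)
  have h2 : (∑ e : G.edges, ∑ x : e.1, u e x • G.tGen x) = 0 := by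
    apply Subtype.ext
    simpa [map_sum, tGen, projGen] using h
  change (G.edges.card : ℂ)⁻¹ • ∑ e : G.edges, ∑ x : e.1, u e x • G.tGen x = 0
  rw [h2, smul_zero]

/-- The canonical map `Φ : S_G → T_G`. -/
def canonicalMap : G.SSys →ₗ[ℂ] G.TSys := G.edgeKernel.liftQ G.preCanonicalMap G.edgeKernel_le

/-- `Φ` sends `a_x` to `p_x`. -/
lemma canonicalMap_sGen (x : V) : G.canonicalMap (G.sGen x) = G.tGen x := by
  classical
  obtain ⟨e, he, hx⟩ := G.covers x
  rw [G.sGen_eq ⟨e, he⟩ ⟨x, hx⟩, map_smul]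
  change (G.edges.card : ℂ) • (G.edges.card : ℂ)⁻¹ • ∑ f : G.edges, ∑ y : f.1,
    G.edgeDelta ⟨e, he⟩ ⟨x, hx⟩ f y • G.tGen y = _
  have hc : (G.edges.card : ℂ) ≠ 0 := by exact_mod_cast G.edges_nonempty.card_pos.ne'
  rw [smul_inv_smul₀ hc, Finset.sum_eq_single ⟨e, he⟩]
  · rw [Finset.sum_eq_single ⟨x, hx⟩]
    · simp [edgeDelta]
    · intro y _ hy; simp [edgeDelta, hy]
    · simp
  · intro f _ hf
    simp [edgeDelta, hf]
  · simp

/-- Unital completely positive maps from `T_G` into `B(H)`. -/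
def IsUCP {H : Type*} [NormedAddCommGroup H] [InnerProductSpace ℂ H] [CompleteSpace H]
    (φ : G.TSys →ₗ[ℂ] (H →L[ℂ] H)) : Prop :=
  φ G.tOne = 1 ∧ IsCP G.tCone (matPos (H →L[ℂ] H)) φ

end ContextualityScenario

end

noncomputable section

namespace ContextualityScenario

section MatPos

variable {A : Type*} [CStarAlgebra A] {n : ℕ}

lemma _root_.CStarAlgebra.nonneg_iff_exists_star_mul_self [PartialOrder A] [StarOrderedRing A]
    {a : A} : 0 ≤ a ↔ ∃ b, a = star b * b :=
  CStarAlgebra.nonneg_iff_eq_star_mul_self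

lemma mem_matPos_iff_nonneg [PartialOrder A] [StarOrderedRing A]
    {M : Matrix (Fin n) (Fin n) A} : M ∈ matPos A n ↔ 0 ≤ CStarMatrix.ofMatrix M := by
  rw [CStarAlgebra.nonneg_iff_exists_star_mul_self]
  exact Iff.rfl

lemma zero_mem_matPos : (0 : Matrix (Fin n) (Fin n) A) ∈ matPos A n := ⟨0, by simp⟩

lemma add_mem_matPos {M N : Matrix (Fin n) (Fin n) A} (hM : M ∈ matPos A n)
    (hN : N ∈ matPos A n) : M + N ∈ matPos A n := by
  let _ := CStarAlgebra.spectralOrder A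
  have _ := CStarAlgebra.spectralOrderedRing A
  rw [mem_matPos_iff_nonneg] at hM hN ⊢
  exact add_nonneg hM hN

lemma sum_mem_matPos {ι : Type*} (s : Finset ι) {M : ι → Matrix (Fin n) (Fin n) A}
    (hM : ∀ i ∈ s, M i ∈ matPos A n) : ∑ i ∈ s, M i ∈ matPos A n :=
  Finset.sum_induction _ (· ∈ matPos A n) (fun _ _ => add_mem_matPos) zero_mem_matPos hM

lemma smul_mem_matPos {M : Matrix (Fin n) (Fin n) A} {r : ℝ} (hr : 0 ≤ r)
    (hM : M ∈ matPos A n) : (r : ℂ) • M ∈ matPos A n := by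
  obtain ⟨B, rfl⟩ := hM
  refine ⟨((√r : ℝ) : ℂ) • B, ?_⟩
  rw [Matrix.conjTranspose_smul, Matrix.smul_mul, Matrix.mul_smul, smul_smul,
    Complex.star_def, Complex.conj_ofReal, ← Complex.ofReal_mul, Real.mul_self_sqrt hr]

lemma isHermitian_of_mem_matPos {M : Matrix (Fin n) (Fin n) A} (hM : M ∈ matPos A n) :
    M.conjTranspose = M := by
  obtain ⟨B, rfl⟩ := hM
  rw [Matrix.conjTranspose_mul, Matrix.conjTranspose_conjTranspose]

/-- A rank-one kernel `b_i* b_j` is positive. -/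
lemma vecMul_mem_matPos (b : Fin n → A) :
    Matrix.of (fun i j => star (b i) * b j) ∈ matPos A n := by
  rcases n with _ | n
  · exact ⟨0, Subsingleton.elim _ _⟩
  · refine ⟨Matrix.of fun k j => if k = 0 then b j else 0, ?_⟩
    ext i j
    simp [Matrix.mul_apply, apply_ite star]

lemma isClosed_matPos : IsClosed (matPos A n) := by
  let _ := CStarAlgebra.spectralOrder A
  have _ := CStarAlgebra.spectralOrderedRing A
  have h : matPos A n = CStarMatrix.ofMatrixL (m := Fin n) (n := Fin n) (A := A) ⁻¹'
      {M | 0 ≤ M} := by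
    ext M
    exact mem_matPos_iff_nonneg
  rw [h]
  exact CStarAlgebra.isClosed_nonneg.preimage (ContinuousLinearEquiv.continuous _)

lemma mem_matPos_of_forall_pos {M : Matrix (Fin n) (Fin n) A}
    (h : ∀ ε : ℝ, 0 < ε → M + Matrix.diagonal (fun _ => (ε : ℂ) • (1 : A)) ∈ matPos A n) :
    M ∈ matPos A n := by
  have hc : Continuous fun ε : ℝ =>
      M + Matrix.diagonal (fun _ : Fin n => (ε : ℂ) • (1 : A)) := by fun_prop
  have hcl := isClosed_matPos (A := A) (n := n)
  have h0 : M + Matrix.diagonal (fun _ : Fin n => ((0 : ℝ) : ℂ) • (1 : A)) = M := by simp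
  rw [← h0]
  refine hcl.mem_of_tendsto (b := nhdsWithin (0 : ℝ) (Set.Ioi 0))
    ((hc.tendsto 0).mono_left nhdsWithin_le_nhds) ?_
  filter_upwards [self_mem_nhdsWithin] with ε hε using h ε hε

lemma eventually_add_conjTranspose_mem_matPos {ε : ℝ} (hε : 0 < ε) :
    ∀ᶠ N in nhds (0 : Matrix (Fin n) (Fin n) A),
      N + N.conjTranspose + Matrix.diagonal (fun _ => (ε : ℂ) • (1 : A)) ∈ matPos A n := by
  let _ := CStarAlgebra.spectralOrder A
  have _ := CStarAlgebra.spectralOrderedRing A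
  have hc : Continuous fun N : Matrix (Fin n) (Fin n) A =>
      ‖CStarMatrix.ofMatrixL (N + N.conjTranspose)‖ :=
    continuous_norm.comp ((ContinuousLinearEquiv.continuous _).comp
      (continuous_id.add continuous_id.matrix_conjTranspose))
  have hlt := hc.tendsto 0
  simp only [Matrix.conjTranspose_zero, add_zero, map_zero, norm_zero] at hlt
  filter_upwards [hlt.eventually (gt_mem_nhds hε)] with N hN
  rw [mem_matPos_iff_nonneg]
  set h : CStarMatrix (Fin n) (Fin n) A := CStarMatrix.ofMatrixL (N + N.conjTranspose) with hh
  have hsa : IsSelfAdjoint h := by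
    change (N + N.conjTranspose).conjTranspose = N + N.conjTranspose
    rw [Matrix.conjTranspose_add, Matrix.conjTranspose_conjTranspose, add_comm]
  have h1 := hsa.neg_algebraMap_norm_le_self
  have h2 : algebraMap ℝ (CStarMatrix (Fin n) (Fin n) A) ‖h‖ ≤ algebraMap ℝ _ ε :=
    algebraMap_mono _ hN.le
  have h3 : 0 ≤ h + algebraMap ℝ _ ε := by
    have := h1.trans (le_refl h)
    rw [neg_le_iff_add_nonneg] at this
    exact this.trans (add_le_add_right h2 h)
  convert h3 using 1
  ext i j
  rw [CStarMatrix.add_apply, Algebra.algebraMap_eq_smul_one, CStarMatrix.smul_apply]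
  change (N + N.conjTranspose) i j + Matrix.diagonal (fun _ => (ε : ℂ) • (1 : A)) i j =
    (N + N.conjTranspose) i j + ε • (1 : Matrix (Fin n) (Fin n) A) i j
  rw [Matrix.diagonal_apply, Matrix.one_apply]
  split_ifs <;> simp

end MatPos

section Operators

variable {H : Type*} [NormedAddCommGroup H] [InnerProductSpace ℂ H] [CompleteSpace H] {n : ℕ}

open scoped ComplexOrder

lemma sum_inner_nonneg_of_mem_matPos {M : Matrix (Fin n) (Fin n) (H →L[ℂ] H)}
    (hM : M ∈ matPos (H →L[ℂ] H) n) (ξ : Fin n → H) :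
    0 ≤ ∑ i, ∑ j, ⟪ξ i, M i j (ξ j)⟫_ℂ := by
  obtain ⟨B, rfl⟩ := hM
  have h : ∑ i, ∑ j, ⟪ξ i, (B.conjTranspose * B) i j (ξ j)⟫_ℂ
      = ∑ k, ⟪∑ i, B k i (ξ i), ∑ j, B k j (ξ j)⟫_ℂ := by
    simp only [Matrix.mul_apply, Matrix.conjTranspose_apply, sum_apply,
      inner_sum, sum_inner, mul_apply_eq_comp, ContinuousLinearMap.star_eq_adjoint,
      ContinuousLinearMap.adjoint_inner_right]
    rw [Finset.sum_comm_cycle]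
    refine Finset.sum_congr rfl fun k _ => ?_
    rw [Finset.sum_comm]
  rw [h]
  refine Finset.sum_nonneg fun k _ => ?_
  rw [inner_self_eq_norm_sq_to_K]
  positivity

/-- Compressing a positive operator on a Hilbert space `K` that decomposes as a direct sum of
copies of `H` gives a positive matrix of operators on `H`. -/
lemma compression_mem_matPos {K : Type*} [NormedAddCommGroup K] [InnerProductSpace ℂ K]
    [CompleteSpace K] (pr : Fin n → K →L[ℂ] H)
    (hone : ∀ η, ∑ k, ContinuousLinearMap.adjoint (pr k) (pr k η) = η) {T : K →L[ℂ] K}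
    (hT : T.IsPositive) :
    Matrix.of (fun i j => pr i ∘L T ∘L ContinuousLinearMap.adjoint (pr j)) ∈
      matPos (H →L[ℂ] H) n := by
  obtain ⟨S, rfl⟩ := CStarAlgebra.nonneg_iff_exists_star_mul_self.1
    ((ContinuousLinearMap.nonneg_iff_isPositive T).2 hT)
  refine ⟨Matrix.of fun k j => pr k ∘L S ∘L ContinuousLinearMap.adjoint (pr j), ?_⟩
  ext i j ξ
  refine ext_inner_left ℂ fun ζ => ?_
  simp only [Matrix.mul_apply, Matrix.conjTranspose_apply, Matrix.of_apply,
    sum_apply, inner_sum, mul_apply_eq_comp,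
    ContinuousLinearMap.star_eq_adjoint, ContinuousLinearMap.adjoint_inner_right,
    ContinuousLinearMap.comp_apply]
  rw [← ContinuousLinearMap.adjoint_inner_left, ContinuousLinearMap.adjoint_inner_right]
  conv_lhs => rw [← hone (S (ContinuousLinearMap.adjoint (pr j) ξ))]
  simp only [inner_sum, ContinuousLinearMap.adjoint_inner_right]

lemma adjoint_proj_apply (i : Fin n) (ξ : H) :
    ContinuousLinearMap.adjoint (PiLp.proj 2 (fun _ : Fin n => H) i : _ →L[ℂ] H) ξ =
      WithLp.toLp 2 (Pi.single i ξ) := by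
  refine ext_inner_right ℂ fun η => ?_
  rw [ContinuousLinearMap.adjoint_inner_left, PiLp.inner_apply, Finset.sum_eq_single i]
  · simp
  · intro b _ hb
    simp [hb]
  · simp

lemma mem_matPos_of_sum_inner_nonneg {M : Matrix (Fin n) (Fin n) (H →L[ℂ] H)}
    (h : ∀ ξ : Fin n → H, 0 ≤ ∑ i, ∑ j, ⟪ξ i, M i j (ξ j)⟫_ℂ) :
    M ∈ matPos (H →L[ℂ] H) n := by
  let pr (i : Fin n) : PiLp 2 (fun _ : Fin n => H) →L[ℂ] H := PiLp.proj 2 (fun _ : Fin n => H) i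
  have hpr : ∀ i η, pr i η = η i := fun _ _ => rfl
  have hone : ∀ η, ∑ k, ContinuousLinearMap.adjoint (pr k) (pr k η) = η := by
    intro η
    refine ext_inner_right ℂ fun ζ => ?_
    simp only [sum_inner, ContinuousLinearMap.adjoint_inner_left, PiLp.inner_apply, hpr]
  let T : PiLp 2 (fun _ : Fin n => H) →L[ℂ] PiLp 2 (fun _ : Fin n => H) :=
    ∑ i, ∑ j, ContinuousLinearMap.adjoint (pr i) ∘L M i j ∘L pr j
  have hT : T.IsPositive := by
    rw [ContinuousLinearMap.isPositive_iff_complex]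
    intro η
    have hη : ⟪η, T η⟫_ℂ = ∑ i, ∑ j, ⟪η i, M i j (η j)⟫_ℂ := by
      simp only [T, sum_apply, inner_sum, ContinuousLinearMap.comp_apply,
        ContinuousLinearMap.adjoint_inner_right, hpr]
    have h0 := h fun i => η i
    rw [← hη] at h0
    obtain ⟨hre, him⟩ := Complex.nonneg_iff.1 h0
    rw [← inner_conj_symm (T η)]
    generalize ⟪η, T η⟫_ℂ = z at hre him
    exact ⟨Complex.ext (by simp) (by simp [← him]), by simpa using hre⟩
  have hTM : Matrix.of (fun i j => pr i ∘L T ∘L ContinuousLinearMap.adjoint (pr j)) = M := by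
    ext i j ξ
    simp only [Matrix.of_apply, ContinuousLinearMap.comp_apply, T, sum_apply, map_sum]
    simp only [pr, adjoint_proj_apply]
    rw [Finset.sum_eq_single i, Finset.sum_eq_single j]
    · simp
    · intro k _ hk
      simp [hk]
    · simp
    · intro k _ hk
      refine Finset.sum_eq_zero fun l _ => ?_
      simp [hk.symm]
    · simp
  rw [← hTM]
  exact compression_mem_matPos pr hone hT

end Operators

/-! ### Dilations of completely positive maps on subspaces of a C*-algebra -/

section Kernels

variable {ι A : Type*} [CStarAlgebra A]

/-- The kernel `(ξ, η) ↦ x(ξ)* y(η)`. -/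
def kerMul (x y : ι →₀ A) : ι × ι →₀ A :=
  Finsupp.onFinset (x.support ×ˢ y.support) (fun p => star (x p.1) * y p.2) fun p hp => by
    rw [Finset.mem_product, Finsupp.mem_support_iff, Finsupp.mem_support_iff]
    exact ⟨fun h => hp (by simp [h]), fun h => hp (by simp [h])⟩

@[simp]
lemma kerMul_apply (x y : ι →₀ A) (p : ι × ι) : kerMul x y p = star (x p.1) * y p.2 := rfl

/-- The adjoint `(ξ, η) ↦ M(η, ξ)*` of a kernel `M`. -/
def kerStar (M : ι × ι →₀ A) : ι × ι →₀ A :=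
  Finsupp.equivMapDomain (Equiv.prodComm ι ι) (M.mapRange star (star_zero A))

@[simp]
lemma kerStar_apply (M : ι × ι →₀ A) (p : ι × ι) : kerStar M p = star (M p.swap) := rfl

lemma kerStar_kerMul (x y : ι →₀ A) : kerStar (kerMul x y) = kerMul y x := by
  ext p; simp

lemma kerMul_single [DecidableEq ι] (ξ η : ι) (a b : A) :
    kerMul (Finsupp.single ξ a) (Finsupp.single η b) =
      Finsupp.single (ξ, η) (star a * b) := by
  ext ⟨i, j⟩
  by_cases h1 : ξ = i <;> by_cases h2 : η = j <;> simp [h1, h2]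

lemma kerMul_add_left (x y z : ι →₀ A) : kerMul (x + y) z = kerMul x z + kerMul y z := by
  ext p; simp [add_mul]

lemma kerMul_add_right (x y z : ι →₀ A) : kerMul x (y + z) = kerMul x y + kerMul x z := by
  ext p; simp [mul_add]

lemma kerMul_smul_left (c : ℂ) (x y : ι →₀ A) : kerMul (c • x) y = star c • kerMul x y := by
  ext p; simp

lemma kerStar_add (M N : ι × ι →₀ A) : kerStar (M + N) = kerStar M + kerStar N := by
  ext p; simp

lemma kerStar_smul (c : ℂ) (M : ι × ι →₀ A) : kerStar (c • M) = star c • kerStar M := by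
  ext p; simp

lemma kerStar_single (ξ η : ι) (a : A) :
    kerStar (Finsupp.single (ξ, η) a) = Finsupp.single (η, ξ) (star a) := by
  classical
  have h := kerStar_kerMul (Finsupp.single ξ 1) (Finsupp.single η a)
  simpa [kerMul_single] using h

/-- The cone of kernels with positive semidefinite hermitian part. -/
def posKernelCone (ι A : Type*) [CStarAlgebra A] : PointedCone ℝ (ι × ι →₀ A) where
  carrier := {M | ∀ (n : ℕ) (v : Fin n → ι),
    Matrix.of (fun i j => (M + kerStar M) (v i, v j)) ∈ matPos A n}
  add_mem' {M N} hM hN n v := by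
    convert add_mem_matPos (hM n v) (hN n v) using 1
    ext i j
    simp
    abel
  zero_mem' n v := by
    convert zero_mem_matPos (A := A) (n := n) using 1
    ext i j
    simp
  smul_mem' c M hM n v := by
    convert smul_mem_matPos c.2 (hM n v) using 1
    ext i j
    simpa using star_smul (c : ℝ) (M (v j, v i))

lemma mem_posKernelCone_of_add_eq {M : ι × ι →₀ A} (x : ι →₀ A)
    (h : M + kerStar M = kerMul x x) : M ∈ posKernelCone ι A := by
  intro n v
  rw [h]
  exact vecMul_mem_matPos fun i => x (v i)

lemma kerMul_self_mem (x : ι →₀ A) : kerMul x x ∈ posKernelCone ι A := by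
  refine mem_posKernelCone_of_add_eq (((√2 : ℝ) : ℂ) • x) ?_
  ext p
  have h2 : ((√2 : ℝ) : ℂ) * ((√2 : ℝ) : ℂ) = 2 := by
    rw [← Complex.ofReal_mul, Real.mul_self_sqrt (by norm_num)]; norm_num
  simp only [kerStar_kerMul, Finsupp.add_apply, kerMul_apply, Finsupp.smul_apply, star_smul,
    smul_mul_smul_comm, Complex.star_def, Complex.conj_ofReal, h2, two_smul]

lemma sub_kerStar_mem (M : ι × ι →₀ A) : M - kerStar M ∈ posKernelCone ι A := by
  refine mem_posKernelCone_of_add_eq 0 ?_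
  ext p
  simp

lemma exists_norm_sq_sub_eq (a : A) :
    ∃ b : A, ((‖a‖ ^ 2 : ℝ) : ℂ) • (1 : A) - star a * a = star b * b := by
  let _ := CStarAlgebra.spectralOrder A
  have _ := CStarAlgebra.spectralOrderedRing A
  refine CStarAlgebra.nonneg_iff_exists_star_mul_self.1 ?_
  have h := CStarAlgebra.star_mul_le_algebraMap_norm_sq (a := a)
  rw [Algebra.algebraMap_eq_smul_one] at h
  rwa [sub_nonneg, Complex.coe_smul]

open Classical in
/-- Every kernel becomes positive after adding a diagonal kernel of scalar multiples of `1`. -/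
lemma exists_add_mem_posKernelCone (T : Submodule ℂ A) (hT : (1 : A) ∈ T) (y : ι × ι →₀ A) :
    ∃ x : ι × ι →₀ A, (∀ p, x p ∈ T) ∧ x + y ∈ posKernelCone ι A := by
  induction y using Finsupp.induction_linear with
  | zero => exact ⟨0, by simp, by simp⟩
  | add y z hy hz =>
    obtain ⟨x, hx, hxy⟩ := hy
    obtain ⟨x', hx', hxz⟩ := hz
    refine ⟨x + x', fun p => T.add_mem (hx p) (hx' p), ?_⟩
    rw [add_add_add_comm]
    exact add_mem hxy hxz
  | single p a =>
    obtain ⟨ξ, η⟩ := p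
    obtain ⟨b, hb⟩ := exists_norm_sq_sub_eq a
    have hdiag : ∀ (ζ : ι) (q : ι × ι), Finsupp.single (ζ, ζ) (1 : A) q ∈ T := by
      intro ζ q
      rw [Finsupp.single_apply]
      split_ifs
      exacts [hT, T.zero_mem]
    let x : ι × ι →₀ A := ((1 / 2 : ℝ) : ℂ) • Finsupp.single (ξ, ξ) 1 +
      ((‖a‖ ^ 2 / 2 : ℝ) : ℂ) • Finsupp.single (η, η) 1
    refine ⟨x, fun q => T.add_mem (T.smul_mem _ (hdiag ξ q)) (T.smul_mem _ (hdiag η q)), ?_⟩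
    have key : x + Finsupp.single (ξ, η) a + kerStar (x + Finsupp.single (ξ, η) a) =
        kerMul (Finsupp.single ξ 1 + Finsupp.single η a)
          (Finsupp.single ξ 1 + Finsupp.single η a) +
        kerMul (Finsupp.single η b) (Finsupp.single η b) := by
      have hd : ∀ (r : ℝ) (ζ : ι), ((r / 2 : ℝ) : ℂ) • Finsupp.single (ζ, ζ) (1 : A) +
          kerStar (((r / 2 : ℝ) : ℂ) • Finsupp.single (ζ, ζ) (1 : A)) =
          Finsupp.single (ζ, ζ) ((r : ℂ) • (1 : A)) := by
        intro r ζ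
        rw [kerStar_smul, kerStar_single, star_one, Complex.star_def, Complex.conj_ofReal,
          ← add_smul, ← Complex.ofReal_add, add_halves, Finsupp.smul_single]
      have h1 := hd 1 ξ
      have h2 := hd (‖a‖ ^ 2) η
      rw [sub_eq_iff_eq_add.1 hb, Finsupp.single_add] at h2
      rw [Complex.ofReal_one, one_smul] at h1
      simp only [kerMul_add_left, kerMul_add_right, kerMul_single, star_one, one_mul, mul_one]
      simp only [x, kerStar_add]
      rw [kerStar_single]
      linear_combination (norm := abel) h1 + h2
    intro n v
    rw [key]
    convert add_mem_matPos (vecMul_mem_matPos fun i =>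
      (Finsupp.single ξ 1 + Finsupp.single η a : ι →₀ A) (v i))
      (vecMul_mem_matPos fun i => (Finsupp.single η b : ι →₀ A) (v i)) using 1
    rfl

end Kernels

/-- A positive functional on the finitely supported kernels with values in `A`. -/
structure PosKernelFunctional (ι A : Type*) [CStarAlgebra A] where
  toLin : (ι × ι →₀ A) →ₗ[ℂ] ℂ
  re_nonneg : ∀ x : ι →₀ A, 0 ≤ (toLin (kerMul x x)).re
  map_kerStar : ∀ M, toLin (kerStar M) = star (toLin M)

section Extension

variable {A : Type*} [CStarAlgebra A] {H : Type*} [NormedAddCommGroup H] [InnerProductSpace ℂ H]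

open scoped ComplexOrder

/-- The functional on kernels indexed by `H` induced by a linear map `A → B(H)`. -/
def kerFunctional (φ : A →ₗ[ℂ] (H →L[ℂ] H)) : (H × H →₀ A) →ₗ[ℂ] ℂ :=
  Finsupp.lsum ℂ fun p : H × H =>
    (innerSL ℂ p.1).toLinearMap ∘ₗ (ContinuousLinearMap.apply ℂ H p.2).toLinearMap ∘ₗ φ

lemma kerFunctional_apply (φ : A →ₗ[ℂ] (H →L[ℂ] H)) (M : H × H →₀ A) :
    kerFunctional φ M = M.sum fun p a => ⟪p.1, φ a p.2⟫_ℂ := rfl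

lemma kerFunctional_single (φ : A →ₗ[ℂ] (H →L[ℂ] H)) (ξ η : H) (a : A) :
    kerFunctional φ (Finsupp.single (ξ, η) a) = ⟪ξ, φ a η⟫_ℂ := by
  rw [kerFunctional_apply, Finsupp.sum_single_index]
  simp

variable [CompleteSpace H]

lemma kerFunctional_kerStar (φ : A →ₗ[ℂ] (H →L[ℂ] H)) (T : Submodule ℂ A)
    (hstar : ∀ t ∈ T, φ (star t) = star (φ t)) (M : H × H →₀ A) (hM : ∀ p, M p ∈ T) :
    kerFunctional φ (kerStar M) = star (kerFunctional φ M) := by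
  have h1 : kerFunctional φ (kerStar M) =
      (M.mapRange star (star_zero A)).sum fun p a => ⟪p.2, φ a p.1⟫_ℂ := by
    rw [kerFunctional_apply, kerStar, Finsupp.equivMapDomain_eq_mapDomain,
      Finsupp.sum_mapDomain_index (by simp) (by simp)]
    rfl
  rw [h1, Finsupp.sum_mapRange_index (by simp), kerFunctional_apply, Finsupp.sum, Finsupp.sum,
    star_sum]
  refine Finset.sum_congr rfl fun p _ => ?_
  rw [hstar _ (hM p), ContinuousLinearMap.star_eq_adjoint,
    ContinuousLinearMap.adjoint_inner_right, Complex.star_def, inner_conj_symm]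

open Classical in
lemma kerFunctional_nonneg (φ : A →ₗ[ℂ] (H →L[ℂ] H)) (M : H × H →₀ A)
    (hM : ∀ (n : ℕ) (v : Fin n → H),
      Matrix.of (fun i j => φ (M (v i, v j))) ∈ matPos (H →L[ℂ] H) n) :
    0 ≤ kerFunctional φ M := by
  let s : Finset H := M.support.image Prod.fst ∪ M.support.image Prod.snd
  have hs : M.support ⊆ s ×ˢ s := by
    intro p hp
    rw [Finset.mem_product]
    exact ⟨Finset.mem_union_left _ (Finset.mem_image_of_mem _ hp),
      Finset.mem_union_right _ (Finset.mem_image_of_mem _ hp)⟩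
  have hsum : kerFunctional φ M = ∑ ξ ∈ s, ∑ η ∈ s, ⟪ξ, φ (M (ξ, η)) η⟫_ℂ := by
    rw [kerFunctional_apply, Finsupp.sum_of_support_subset _ hs _ (by simp), Finset.sum_product]
  let v : Fin s.card → H := fun i => s.equivFin.symm i
  have hre : ∀ F : H → ℂ, ∑ ξ ∈ s, F ξ = ∑ i, F (v i) := by
    intro F
    rw [← Finset.sum_coe_sort s F]
    exact (Equiv.sum_comp s.equivFin.symm fun i : s => F i).symm
  rw [hsum, hre]
  simp only [hre]
  exact sum_inner_nonneg_of_mem_matPos (hM _ v) v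

/-- A map that is completely positive on `T ⊆ A` induces a functional on kernels with values in
`T`, which extends to a positive functional on all kernels. -/
theorem exists_posKernelFunctional (T : Submodule ℂ A) (hone : (1 : A) ∈ T)
    (φ : A →ₗ[ℂ] (H →L[ℂ] H)) (hT : ∀ t ∈ T, star t ∈ T)
    (hstar : ∀ t ∈ T, φ (star t) = star (φ t))
    (hcp : ∀ (n : ℕ) (M : Matrix (Fin n) (Fin n) A), (∀ i j, M i j ∈ T) → M ∈ matPos A n →
      M.map φ ∈ matPos (H →L[ℂ] H) n) :
    ∃ g : PosKernelFunctional H A, ∀ t ∈ T, ∀ ξ η : H,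
      g.toLin (Finsupp.single (ξ, η) t) = ⟪ξ, φ t η⟫_ℂ := by
  classical
  let D : Submodule ℂ (H × H →₀ A) :=
    { carrier := {M | ∀ p, M p ∈ T}
      add_mem' := fun hM hN p => T.add_mem (hM p) (hN p)
      zero_mem' := fun p => T.zero_mem
      smul_mem' := fun c M hM p => T.smul_mem c (hM p) }
  let f : (H × H →₀ A) →ₗ.[ℝ] ℝ :=
    { domain := D.restrictScalars ℝ
      toFun := (Complex.reLm ∘ₗ (kerFunctional φ).restrictScalars ℝ).domRestrict _ }
  have hf : ∀ x : f.domain, f x = (kerFunctional φ x).re := fun _ => rfl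
  obtain ⟨g, hgf, hg⟩ := riesz_extension (posKernelCone H A) f (by
    intro x hx
    have hxT : ∀ p, (x : H × H →₀ A) p ∈ T := x.2
    have h := kerFunctional_nonneg φ ((x : H × H →₀ A) + kerStar x) (fun n v =>
      hcp n _ (fun i j => T.add_mem (hxT _) (hT _ (hxT _))) (hx n v))
    rw [map_add, kerFunctional_kerStar φ T hstar _ hxT] at h
    have := (Complex.nonneg_iff.1 h).1
    simp at this
    rw [hf]
    linarith) (by
    intro y
    obtain ⟨x, hx, hxy⟩ := exists_add_mem_posKernelCone T hone y
    exact ⟨⟨x, hx⟩, hxy⟩)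
  have hgstar : ∀ M, g (kerStar M) = g M := by
    intro M
    have h1 := hg _ (sub_kerStar_mem M)
    have h2 := hg _ (sub_kerStar_mem (kerStar M))
    have h3 : kerStar (kerStar M) = M := by ext p; simp
    rw [h3] at h2
    rw [map_sub] at h1 h2
    linarith
  refine ⟨⟨Module.Dual.extendRCLike g, fun x => ?_, fun M => ?_⟩, fun t ht ξ η => ?_⟩
  · have := hg _ (kerMul_self_mem x)
    rw [← Module.Dual.re_extendRCLike_apply (𝕜 := ℂ)] at this
    exact this
  · have h : kerStar (Complex.I • M) = -(Complex.I • kerStar M) := by ext p; simp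
    have h2 := hgstar (Complex.I • M)
    rw [h, map_neg] at h2
    simp only [Module.Dual.extendRCLike_apply, hgstar]
    apply Complex.ext
    · simp
    · simp
      exact h2
  · have hmem : ∀ c : ℂ, g (c • Finsupp.single (ξ, η) t) = (c * ⟪ξ, φ t η⟫_ℂ).re := by
      intro c
      have hc : c • Finsupp.single (ξ, η) t ∈ D := by
        refine D.smul_mem c fun p => ?_
        rw [Finsupp.single_apply]
        split_ifs
        exacts [ht, T.zero_mem]
      have := hgf ⟨_, hc⟩
      rw [hf] at this
      rw [this]
      simp only [map_smul, kerFunctional_single, smul_eq_mul]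
    have h1 := hmem 1
    rw [one_smul, one_mul] at h1
    have h2 := hmem Complex.I
    simp only [Module.Dual.extendRCLike_apply]
    apply Complex.ext
    · simp [h1]
    · simpa [h1, neg_eq_iff_eq_neg] using h2

end Extension

namespace PosKernelFunctional

variable {ι A : Type*} [CStarAlgebra A] (g : PosKernelFunctional ι A)

/-- The finitely supported functions `ι → A`, to carry the semi-inner product of `g`. -/
def PreSpace (_g : PosKernelFunctional ι A) : Type _ := ι →₀ A

instance : AddCommGroup g.PreSpace := inferInstanceAs (AddCommGroup (ι →₀ A))
instance : Module ℂ g.PreSpace := inferInstanceAs (Module ℂ (ι →₀ A))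

/-- The underlying function of an element of `PreSpace`. -/
def toFinsupp : g.PreSpace ≃ₗ[ℂ] (ι →₀ A) := LinearEquiv.refl ℂ _

/-- The semi-inner product `⟨x, y⟩ = g(x* y)`. -/
abbrev preCore : PreInnerProductSpace.Core ℂ g.PreSpace where
  inner x y := g.toLin (kerMul (g.toFinsupp x) (g.toFinsupp y))
  conj_inner_symm x y := by
    rw [← kerStar_kerMul, g.map_kerStar]
    exact star_star _
  re_inner_nonneg x := g.re_nonneg _
  add_left x y z := by rw [map_add, kerMul_add_left, map_add]
  smul_left x y c := by
    rw [map_smul, kerMul_smul_left, map_smul]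
    rfl

instance : SeminormedAddCommGroup g.PreSpace :=
  InnerProductSpace.Core.toSeminormedAddCommGroup (c := g.preCore)
instance : InnerProductSpace ℂ g.PreSpace := InnerProductSpace.ofCore g.preCore

/-- The generator `a ⊗ δ_ξ`. -/
def vec (ξ : ι) (a : A) : g.PreSpace := g.toFinsupp.symm (Finsupp.single ξ a)

lemma toFinsupp_vec (ξ : ι) (a : A) : g.toFinsupp (g.vec ξ a) = Finsupp.single ξ a := rfl

lemma inner_def (x y : g.PreSpace) :
    ⟪x, y⟫_ℂ = g.toLin (kerMul (g.toFinsupp x) (g.toFinsupp y)) := rfl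

lemma inner_vec (ξ η : ι) (a b : A) :
    ⟪g.vec ξ a, g.vec η b⟫_ℂ = g.toLin (Finsupp.single (ξ, η) (star a * b)) := by
  classical
  rw [inner_def, toFinsupp_vec, toFinsupp_vec, kerMul_single]

/-- Left multiplication on `PreSpace`. -/
def preMul (a : A) : g.PreSpace →ₗ[ℂ] g.PreSpace :=
  g.toFinsupp.symm.toLinearMap ∘ₗ Finsupp.mapRange.linearMap (LinearMap.mulLeft ℂ a) ∘ₗ
    g.toFinsupp.toLinearMap

lemma toFinsupp_preMul_apply (a : A) (x : g.PreSpace) (i : ι) :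
    g.toFinsupp (g.preMul a x) i = a * g.toFinsupp x i := rfl

lemma ext_toFinsupp {x y : g.PreSpace} (h : ∀ i, g.toFinsupp x i = g.toFinsupp y i) : x = y :=
  g.toFinsupp.injective (Finsupp.ext h)

lemma preMul_vec (a b : A) (ξ : ι) : g.preMul a (g.vec ξ b) = g.vec ξ (a * b) := by
  classical
  refine g.ext_toFinsupp fun i => ?_
  simp only [toFinsupp_preMul_apply, toFinsupp_vec, Finsupp.single_apply, mul_ite, mul_zero]

lemma inner_preMul_left (a : A) (x y : g.PreSpace) :
    ⟪g.preMul a x, y⟫_ℂ = ⟪x, g.preMul (star a) y⟫_ℂ := by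
  rw [inner_def, inner_def]
  congr 1
  ext p
  simp only [kerMul_apply, toFinsupp_preMul_apply, star_mul, mul_assoc]

lemma norm_preMul_le (a : A) (x : g.PreSpace) : ‖g.preMul a x‖ ≤ ‖a‖ * ‖x‖ := by
  obtain ⟨b, hb⟩ := exists_norm_sq_sub_eq a
  have h : ⟪x, (((‖a‖ ^ 2 : ℝ) : ℂ) • x)⟫_ℂ - ⟪g.preMul a x, g.preMul a x⟫_ℂ =
      ⟪g.preMul b x, g.preMul b x⟫_ℂ := by
    simp only [inner_def]
    rw [← map_sub]
    congr 1
    ext p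
    simp only [Finsupp.sub_apply, map_smul, Finsupp.smul_apply, kerMul_apply,
      toFinsupp_preMul_apply, star_mul]
    have hassoc : ∀ s c t : A, s * star c * (c * t) = s * (star c * c * t) := by
      intro s c t
      simp only [mul_assoc]
    rw [hassoc, hassoc, ← hb, ← mul_sub, sub_mul, smul_mul_assoc, one_mul]
  have h2 := congrArg Complex.re h
  rw [inner_smul_right, inner_self_eq_norm_sq_to_K, inner_self_eq_norm_sq_to_K,
    inner_self_eq_norm_sq_to_K] at h2
  norm_cast at h2
  rw [Complex.sub_re, Complex.re_ofReal_mul] at h2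
  simp only [Complex.coe_algebraMap, Complex.ofReal_re] at h2
  refine abs_le_of_sq_le_sq' ?_ (by positivity) |>.2
  nlinarith [sq_nonneg ‖g.preMul b x‖]

/-- The Hilbert space of `g`. -/
abbrev Space : Type _ := UniformSpace.Completion g.PreSpace

/-- Left multiplication as a bounded operator on `PreSpace`. -/
def preMulL (a : A) : g.PreSpace →L[ℂ] g.PreSpace :=
  (g.preMul a).mkContinuous ‖a‖ (g.norm_preMul_le a)

/-- The representation of `A` on the Hilbert space of `g`. -/
def rep (a : A) : g.Space →L[ℂ] g.Space := (g.preMulL a).completion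

lemma rep_coe (a : A) (x : g.PreSpace) : g.rep a (x : g.Space) = (g.preMul a x : g.PreSpace) :=
  ContinuousLinearMap.completion_apply_coe _ _

lemma ext_rep {S T : g.Space →L[ℂ] g.Space} (h : ∀ x : g.PreSpace, S x = T x) : S = T := by
  ext x
  induction x using UniformSpace.Completion.induction_on with
  | hp => exact isClosed_eq S.continuous T.continuous
  | ih x => exact h x

lemma rep_one : g.rep 1 = 1 := g.ext_rep fun x => by
  rw [rep_coe]
  congr 1
  exact g.ext_toFinsupp fun i => one_mul _

lemma rep_mul (a b : A) : g.rep (a * b) = g.rep a * g.rep b := g.ext_rep fun x => by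
  rw [mul_apply_eq_comp, rep_coe, rep_coe, rep_coe]
  congr 1
  exact g.ext_toFinsupp fun i => mul_assoc _ _ _

lemma rep_add (a b : A) : g.rep (a + b) = g.rep a + g.rep b := g.ext_rep fun x => by
  rw [add_apply, rep_coe, rep_coe, rep_coe, ← UniformSpace.Completion.coe_add]
  congr 1
  exact g.ext_toFinsupp fun i => add_mul _ _ _

lemma rep_star (a : A) : g.rep (star a) = star (g.rep a) := by
  rw [ContinuousLinearMap.star_eq_adjoint, ContinuousLinearMap.eq_adjoint_iff]
  intro x y
  induction x, y using UniformSpace.Completion.induction_on₂ with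
  | hp => apply isClosed_eq <;> fun_prop
  | ih x y =>
    rw [rep_coe, rep_coe, UniformSpace.Completion.inner_coe, UniformSpace.Completion.inner_coe,
      inner_preMul_left, star_star]

end PosKernelFunctional

section Dilation

variable {A H : Type*} [CStarAlgebra A] [NormedAddCommGroup H] [InnerProductSpace ℂ H]
  [CompleteSpace H]

/-- If a positive functional on kernels indexed by `H` restricts to the inner product of `H`,
then `ξ ↦ 1 ⊗ δ_ξ` is a linear isometry. -/
def PosKernelFunctional.isometry (g : PosKernelFunctional H A)
    (hg : ∀ ξ η : H, g.toLin (Finsupp.single (ξ, η) 1) = ⟪ξ, η⟫_ℂ) : H →ₗᵢ[ℂ] g.Space :=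
  have hin : ∀ ξ η : H, ⟪(g.vec ξ 1 : g.Space), (g.vec η 1 : g.Space)⟫_ℂ = ⟪ξ, η⟫_ℂ := by
    intro ξ η
    rw [UniformSpace.Completion.inner_coe, g.inner_vec, star_one, one_mul, hg]
  { toFun := fun ξ => (g.vec ξ 1 : g.Space)
    map_add' := fun ξ η => by
      rw [← sub_eq_zero, ← inner_self_eq_zero (𝕜 := ℂ)]
      simp only [inner_sub_left, inner_sub_right, inner_add_left, inner_add_right, hin]
      ring
    map_smul' := fun c ξ => by
      rw [← sub_eq_zero, ← inner_self_eq_zero (𝕜 := ℂ)]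
      simp only [inner_sub_left, inner_sub_right, inner_smul_left, inner_smul_right, hin,
        RingHom.id_apply]
      ring
    norm_map' := fun ξ => by
      have h := hin ξ ξ
      rw [inner_self_eq_norm_sq_to_K, inner_self_eq_norm_sq_to_K] at h
      have h' : ‖(g.vec ξ 1 : g.Space)‖ ^ 2 = ‖ξ‖ ^ 2 := by exact_mod_cast h
      exact (pow_left_inj₀ (norm_nonneg _) (norm_nonneg _) two_ne_zero).1 h' }

end Dilation

section Representation

variable {V : Type u} [Fintype V] {G : ContextualityScenario V}
  {H : Type u} [NormedAddCommGroup H] [InnerProductSpace ℂ H] [CompleteSpace H]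

/-- The universal property of `C*(G)`: a PR extends to a *-representation. -/
theorem IsPR.exists_rep {P : V → H →L[ℂ] H} (hP : G.IsPR P) :
    ∃ π : G.CStar →ₐ[ℂ] (H →L[ℂ] H), (∀ x, π (G.projGen x) = P x) ∧
      ∀ a, π (star a) = star (π a) := by
  have hcont : Continuous (G.eval P).toRingHom :=
    AddMonoidHomClass.continuous_of_bound (G.eval P) 1 fun a => by
      rw [one_mul]
      exact hP.norm_eval_le a
  let ρ : G.CStar →+* (H →L[ℂ] H) :=
    UniformSpace.Completion.extensionHom (G.eval P).toRingHom hcont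
  have hρ : ∀ a, ρ (G.toCStar a) = G.eval P a := fun a =>
    UniformSpace.Completion.extensionHom_coe _ hcont a
  have hρc : Continuous ρ := UniformSpace.Completion.continuous_extension
  refine ⟨{ ρ with commutes' := fun c => ?_ }, fun x => ?_, fun a => ?_⟩
  · have h := hρ (algebraMap ℂ _ c)
    rw [AlgHom.commutes, AlgHom.commutes] at h
    exact h
  · exact (hρ _).trans (G.eval_gen P x)
  · change ρ (star a) = star (ρ a)
    refine G.denseRange_toCStar.induction_on (p := fun a => ρ (star a) = star (ρ a)) a
      (isClosed_eq (hρc.comp G.continuous_star_cstar) (continuous_star.comp hρc)) fun a => ?_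
    rw [star_toCStar, hρ, hρ, hP.eval_star]

lemma star_mem_TSys {t : G.CStar} (ht : t ∈ G.TSys) : star t ∈ G.TSys := by
  induction ht using Submodule.span_induction with
  | mem t ht =>
    obtain ⟨x, rfl⟩ := ht
    rw [(G.isStarProjection_projGen x).isSelfAdjoint.star_eq]
    exact (G.tGen x).2
  | zero => rw [star_zero]; exact zero_mem _
  | add s t _ _ hs ht => rw [star_add]; exact add_mem hs ht
  | smul c t _ ht => rw [star_smul]; exact Submodule.smul_mem _ _ ht

lemma span_range_tGen : Submodule.span ℂ (Set.range G.tGen) = ⊤ := by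
  rw [eq_top_iff]
  rintro ⟨t, ht⟩ -
  induction ht using Submodule.span_induction with
  | mem t ht =>
    obtain ⟨x, rfl⟩ := ht
    exact Submodule.subset_span ⟨x, rfl⟩
  | zero => exact zero_mem _
  | add s t _ _ hs ht => exact add_mem hs ht
  | smul c t _ ht => exact Submodule.smul_mem _ c ht

lemma TSys_hom_ext {E : Type*} [AddCommGroup E] [Module ℂ E] {φ ψ : G.TSys →ₗ[ℂ] E}
    (h : ∀ x, φ (G.tGen x) = ψ (G.tGen x)) : φ = ψ :=
  LinearMap.ext_on_range span_range_tGen h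

lemma IsUCP.pos {φ : G.TSys →ₗ[ℂ] (H →L[ℂ] H)} (hφ : G.IsUCP φ) (x : V) :
    (φ (G.tGen x)).IsPositive := by
  obtain ⟨B, hB⟩ := hφ.2 1 (Matrix.of fun _ _ => G.tGen x) ⟨Matrix.of fun _ _ => G.projGen x, by
    ext i j
    have h := G.isStarProjection_projGen x
    simp [Matrix.mul_apply, tGen, h.isSelfAdjoint.star_eq, h.isIdempotentElem.eq]⟩
  have h := congrFun (congrFun hB 0) 0
  simp only [Matrix.map_apply, Matrix.of_apply, Matrix.mul_apply, Matrix.conjTranspose_apply,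
    Finset.univ_unique, Finset.sum_singleton] at h
  rw [h, ← ContinuousLinearMap.nonneg_iff_isPositive]
  exact star_mul_self_nonneg _

lemma IsUCP.isPOR {φ : G.TSys →ₗ[ℂ] (H →L[ℂ] H)} (hφ : G.IsUCP φ) :
    G.IsPOR fun x => φ (G.tGen x) where
  pos := hφ.pos
  sum_eq e he := by
    rw [← map_sum, ← hφ.1]
    congr 1
    apply Subtype.ext
    rw [Submodule.coe_sum]
    exact G.sum_projGen he

theorem IsUCP.isDilatablePOR {φ : G.TSys →ₗ[ℂ] (H →L[ℂ] H)} (hφ : G.IsUCP φ) :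
    G.IsDilatablePOR fun x => φ (G.tGen x) := by
  refine ⟨hφ.isPOR, ?_⟩
  obtain ⟨ψ, hψ⟩ := φ.exists_extend
  have hψt : ∀ t : G.TSys, ψ t = φ t := fun t => LinearMap.congr_fun hψ t
  have hψ1 : ψ 1 = 1 := (hψt G.tOne).trans hφ.1
  have hstar : ∀ t ∈ G.TSys, ψ (star t) = star (ψ t) := by
    intro t ht
    induction ht using Submodule.span_induction with
    | mem t ht =>
      obtain ⟨x, rfl⟩ := ht
      rw [(G.isStarProjection_projGen x).isSelfAdjoint.star_eq]
      have h := (hφ.pos x).isSelfAdjoint.star_eq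
      rw [← hψt] at h
      exact h.symm
    | zero => simp
    | add s t _ _ hs ht => simp only [star_add, map_add, hs, ht]
    | smul c t _ ht => simp only [star_smul, map_smul, ht]
  obtain ⟨g, hg⟩ := exists_posKernelFunctional G.TSys G.one_mem_TSys ψ
    (fun t => star_mem_TSys) hstar (fun n M hMT hM => by
      have h := hφ.2 n (Matrix.of fun i j => ⟨M i j, hMT i j⟩) hM
      convert h using 1
      refine Matrix.ext fun i j => ?_
      exact hψt ⟨M i j, hMT i j⟩)
  let W := g.isometry fun ξ η => by
    rw [hg 1 G.one_mem_TSys, hψ1]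
    rfl
  have hW : ∀ ξ, W ξ = (g.vec ξ 1 : g.PreSpace) := fun _ => rfl
  have hproj : ∀ x, IsStarProjection (g.rep (G.projGen x)) := fun x =>
    { isIdempotentElem := by
        rw [IsIdempotentElem, ← g.rep_mul, (G.isStarProjection_projGen x).isIdempotentElem.eq]
      isSelfAdjoint := by
        rw [IsSelfAdjoint, ← g.rep_star, (G.isStarProjection_projGen x).isSelfAdjoint.star_eq] }
  refine ⟨g.Space, inferInstance, inferInstance, inferInstance, fun x => g.rep (G.projGen x),
    { pos := fun x => ?_, sum_eq := fun e he => ?_, proj := hproj }, W, fun x => ?_⟩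
  · rw [← ContinuousLinearMap.nonneg_iff_isPositive]
    exact (hproj x).nonneg
  · let r : G.CStar →+ (g.Space →L[ℂ] g.Space) := AddMonoidHom.mk' g.rep g.rep_add
    have h := map_sum r G.projGen e
    rw [G.sum_projGen he] at h
    exact h.symm.trans g.rep_one
  · ext η
    refine ext_inner_left ℂ fun ξ => ?_
    rw [ContinuousLinearMap.comp_apply, ContinuousLinearMap.adjoint_inner_right,
      ContinuousLinearMap.comp_apply]
    change _ = ⟪W ξ, g.rep (G.projGen x) (W η)⟫_ℂ
    rw [hW, hW, g.rep_coe, UniformSpace.Completion.inner_coe, g.preMul_vec, g.inner_vec, star_one,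
      one_mul, mul_one, hg (G.projGen x) (G.tGen x).2]
    exact congrArg (fun S : H →L[ℂ] H => ⟪ξ, S η⟫_ℂ) (hψt (G.tGen x)).symm

/-- The compression `S ↦ W* S W`. -/
def compression {K : Type*} [NormedAddCommGroup K] [InnerProductSpace ℂ K] [CompleteSpace K]
    (W : H →L[ℂ] K) : (K →L[ℂ] K) →ₗ[ℂ] (H →L[ℂ] H) where
  toFun S := ContinuousLinearMap.adjoint W ∘L S ∘L W
  map_add' S T := by ext; simp
  map_smul' c S := by ext; simp

lemma inner_compression {K : Type*} [NormedAddCommGroup K] [InnerProductSpace ℂ K]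
    [CompleteSpace K] (W : H →L[ℂ] K) (S : K →L[ℂ] K) (ξ η : H) :
    ⟪ξ, compression W S η⟫_ℂ = ⟪W ξ, S (W η)⟫_ℂ := by
  rw [← ContinuousLinearMap.adjoint_inner_right]
  rfl

open scoped ComplexOrder in
theorem IsDilatablePOR.exists_isUCP {A : V → H →L[ℂ] H} (hA : G.IsDilatablePOR A) :
    ∃ φ : G.TSys →ₗ[ℂ] (H →L[ℂ] H), G.IsUCP φ ∧ ∀ x, φ (G.tGen x) = A x := by
  obtain ⟨hA, K, _, _, _, P, hP, W, hW⟩ := hA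
  obtain ⟨π, hπ, hπstar⟩ := hP.exists_rep
  let φ : G.TSys →ₗ[ℂ] (H →L[ℂ] H) :=
    compression W.toContinuousLinearMap ∘ₗ π.toLinearMap ∘ₗ G.TSys.subtype
  have hφ : ∀ t ξ η, ⟪ξ, φ t η⟫_ℂ = ⟪W ξ, π t (W η)⟫_ℂ := fun t ξ η =>
    inner_compression _ _ _ _
  have hφA : ∀ x, φ (G.tGen x) = A x := by
    intro x
    rw [hW x, ← hπ x]
    rfl
  refine ⟨φ, ⟨?_, fun n M hM => mem_matPos_of_sum_inner_nonneg fun ξ => ?_⟩, hφA⟩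
  · ext η
    refine ext_inner_left ℂ fun ξ => ?_
    rw [hφ]
    change ⟪W ξ, π 1 (W η)⟫_ℂ = ⟪ξ, η⟫_ℂ
    rw [map_one]
    exact W.inner_map_map ξ η
  · simp only [Matrix.map_apply, hφ]
    obtain ⟨B, hB⟩ := hM
    have hM' : Matrix.of (fun i j => π (M i j)) ∈ matPos (K →L[ℂ] K) n := by
      refine ⟨B.map π, ?_⟩
      refine Matrix.ext fun i j => ?_
      have h := congrArg π (congrFun (congrFun hB i) j)
      simpa [Matrix.mul_apply, hπstar] using h
    exact sum_inner_nonneg_of_mem_matPos hM' fun i => W (ξ i)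

end Representation

section EdgeMap

variable {V : Type u} [Fintype V] (G : ContextualityScenario V)

lemma card_edges_ne_zero : (G.edges.card : ℂ) ≠ 0 := by
  exact_mod_cast G.edges_nonempty.card_pos.ne'

/-- The linear map `u ↦ |E|⁻¹ ∑_e ∑_{x ∈ e} u_x^e a_x` induced by a family `(a_x)`. -/
def edgeMap {E : Type*} [AddCommGroup E] [Module ℂ E] (a : V → E) : G.EdgeAlg →ₗ[ℂ] E where
  toFun u := (G.edges.card : ℂ)⁻¹ • ∑ e : G.edges, ∑ x : e.1, u e x • a x
  map_add' u v := by simp [add_smul, Finset.sum_add_distrib]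
  map_smul' c u := by simp [Finset.smul_sum, smul_smul, mul_left_comm]

section Module

variable {E F : Type*} [AddCommGroup E] [Module ℂ E] [AddCommGroup F] [Module ℂ F]

lemma edgeMap_apply (a : V → E) (u : G.EdgeAlg) :
    G.edgeMap a u = (G.edges.card : ℂ)⁻¹ • ∑ e : G.edges, ∑ x : e.1, u e x • a x := rfl

lemma map_edgeMap (T : E →ₗ[ℂ] F) (a : V → E) (u : G.EdgeAlg) :
    T (G.edgeMap a u) = G.edgeMap (fun x => T (a x)) u := by
  simp only [edgeMap_apply, map_smul, map_sum]

lemma edgeMap_one {a : V → E} {q : E} (h : ∀ e ∈ G.edges, ∑ x ∈ e, a x = q) :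
    G.edgeMap a 1 = q := by
  have h1 : ∀ e : G.edges, ∑ x : e.1, (1 : G.EdgeAlg) e x • a x = q := by
    intro e
    simp only [Pi.one_apply, one_smul]
    rw [Finset.sum_coe_sort e.1 a, h e.1 e.2]
  rw [edgeMap_apply, Finset.sum_congr rfl fun e _ => h1 e, Finset.sum_const, Finset.card_univ,
    Fintype.card_coe, ← Nat.cast_smul_eq_nsmul ℂ, inv_smul_smul₀ G.card_edges_ne_zero]

/-- The quotient map `⊕_e ℓ^∞_e → S_G` in terms of the generators `a_x`. -/
lemma edgeMap_sGen (u : G.EdgeAlg) : G.edgeMap G.sGen u = G.edgeKernel.mkQ u := by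
  have hu : u = ∑ e : G.edges, ∑ x : e.1, u e x • G.edgeDelta e x := by
    classical
    ext f y
    simp only [Finset.sum_apply, Pi.smul_apply, smul_eq_mul]
    rw [Finset.sum_eq_single f, Finset.sum_eq_single y]
    · simp [edgeDelta]
    · intro x _ hx; simp [edgeDelta, hx.symm]
    · simp
    · intro e _ he
      simp [edgeDelta, he.symm]
    · simp
  conv_rhs => rw [hu]
  simp only [map_sum, map_smul, edgeMap_apply, G.sGen_eq, Finset.smul_sum]
  refine Finset.sum_congr rfl fun e _ => Finset.sum_congr rfl fun x _ => ?_
  rw [smul_comm (u e x), inv_smul_smul₀ G.card_edges_ne_zero]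

lemma map_mkQ_eq_edgeMap (T : G.SSys →ₗ[ℂ] E) (u : G.EdgeAlg) :
    T (G.edgeKernel.mkQ u) = G.edgeMap (fun x => T (G.sGen x)) u := by
  rw [← edgeMap_sGen, map_edgeMap]

variable {G} in
lemma SSys_hom_ext {S T : G.SSys →ₗ[ℂ] E} (h : ∀ x, S (G.sGen x) = T (G.sGen x)) : S = T := by
  refine Submodule.linearMap_qext _ (LinearMap.ext fun u => ?_)
  rw [LinearMap.comp_apply, LinearMap.comp_apply, map_mkQ_eq_edgeMap, map_mkQ_eq_edgeMap]
  simp only [h]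

end Module

lemma sum_sGen {e : Finset V} (he : e ∈ G.edges) : ∑ x ∈ e, G.sGen x = G.sOne := by
  rw [← Finset.sum_coe_sort e, Finset.sum_congr rfl fun x _ => G.sGen_eq ⟨e, he⟩ x,
    ← Finset.smul_sum, ← map_sum, ← map_smul, sOne, ← sub_eq_zero, ← map_sub,
    Submodule.mkQ_apply, Submodule.Quotient.mk_eq_zero, mem_edgeKernel]
  intro p hp
  have hc : ∀ f ∈ G.edges, ∑ x : f, (p x : ℂ) = 1 := by
    intro f hf
    rw [Finset.sum_coe_sort f fun x => (p x : ℂ), ← Complex.ofReal_sum, hp.2 f hf,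
      Complex.ofReal_one]
  have h1 : G.pairing p 1 = G.edges.card := by
    change ∑ f : G.edges, ∑ x : f.1, (p x : ℂ) * 1 = _
    simp only [mul_one]
    rw [Finset.sum_congr rfl fun f _ => hc f.1 f.2]
    simp
  rw [map_sub, map_smul, map_sum, h1]
  simp only [pairing_edgeDelta]
  rw [hc e he, smul_eq_mul, mul_one, sub_self]

lemma canonicalMap_mkQ (u : G.EdgeAlg) :
    (G.canonicalMap (G.edgeKernel.mkQ u) : G.CStar) = G.edgeMap G.projGen u := by
  rw [map_mkQ_eq_edgeMap]
  simp only [canonicalMap_sGen]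
  exact G.map_edgeMap G.TSys.subtype G.tGen u

lemma canonicalMap_sOne : G.canonicalMap G.sOne = G.tOne := by
  apply Subtype.ext
  rw [sOne, canonicalMap_mkQ]
  exact G.edgeMap_one fun e he => G.sum_projGen he

section CP

variable {A : Type*} [CStarAlgebra A] {n : ℕ}

lemma edgeMap_star {a : V → A} (ha : ∀ x, star (a x) = a x) (u : G.EdgeAlg) :
    G.edgeMap a (star u) = star (G.edgeMap a u) := by
  simp [edgeMap_apply, star_sum, ha]

lemma edgeMap_mem_matPos {a : V → A} (ha : ∀ x, ∃ b, a x = star b * b)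
    {N : Matrix (Fin n) (Fin n) G.EdgeAlg} (hN : N ∈ matPos G.EdgeAlg n) :
    N.map (G.edgeMap a) ∈ matPos A n := by
  obtain ⟨B, rfl⟩ := hN
  choose b hb using ha
  have h : (B.conjTranspose * B).map (G.edgeMap a) = (((G.edges.card : ℝ)⁻¹ : ℝ) : ℂ) •
      ∑ e : G.edges, ∑ x : e.1, (Matrix.of fun i j => B i j e x • b x).conjTranspose *
        Matrix.of fun i j => B i j e x • b x := by
    refine Matrix.ext fun i j => ?_
    simp only [Matrix.map_apply, edgeMap_apply, Matrix.smul_apply, Matrix.sum_apply,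
      Matrix.mul_apply, Matrix.conjTranspose_apply, Matrix.of_apply, Finset.sum_apply,
      Pi.mul_apply, Pi.star_apply, star_smul, smul_mul_smul_comm, Finset.sum_smul, hb,
      Complex.ofReal_inv, Complex.ofReal_natCast]
  rw [h]
  exact smul_mem_matPos (by positivity)
    (sum_mem_matPos _ fun e _ => sum_mem_matPos _ fun x _ => ⟨_, rfl⟩)

/-- A unital map on `S_G` that is positive on the generators is completely positive. -/
lemma map_mem_matPos_of_mem_sCone {T : G.SSys →ₗ[ℂ] A} (hT : ∀ x, ∃ b, T (G.sGen x) = star b * b)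
    (hT1 : T G.sOne = 1) {U : Matrix (Fin n) (Fin n) G.SSys} (hU : U ∈ G.sCone n) :
    U.map T ∈ matPos A n := by
  refine mem_matPos_of_forall_pos fun ε hε => ?_
  obtain ⟨M, hM, hMU⟩ := hU ε hε
  convert G.edgeMap_mem_matPos hT hM using 1
  refine Matrix.ext fun i j => ?_
  rw [Matrix.map_apply, ← map_mkQ_eq_edgeMap]
  have h := congrArg T (congrFun (congrFun hMU i) j)
  rw [Matrix.map_apply] at h
  rw [h, Matrix.add_apply, Matrix.add_apply, map_add, Matrix.map_apply, Matrix.diagonal_apply,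
    Matrix.diagonal_apply]
  split_ifs <;> simp [hT1]

end CP

lemma isCP_canonicalMap : IsCP G.sCone G.tCone G.canonicalMap := by
  intro n U hU
  have h := G.map_mem_matPos_of_mem_sCone (T := G.TSys.subtype ∘ₗ G.canonicalMap) (fun x =>
    ⟨G.projGen x, by
      have h := G.isStarProjection_projGen x
      rw [h.isSelfAdjoint.star_eq, h.isIdempotentElem.eq, LinearMap.comp_apply,
        canonicalMap_sGen]
      rfl⟩)
    (by rw [LinearMap.comp_apply, canonicalMap_sOne]; rfl) hU
  exact h

lemma canonicalMap_surjective : Function.Surjective G.canonicalMap := by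
  rw [← LinearMap.range_eq_top, eq_top_iff, ← span_range_tGen, Submodule.span_le]
  rintro _ ⟨x, rfl⟩
  exact ⟨G.sGen x, G.canonicalMap_sGen x⟩

variable {H : Type u} [NormedAddCommGroup H] [InnerProductSpace ℂ H] [CompleteSpace H]

variable {G}

/-- The map `S_G → B(H)`, `a_x ↦ A_x`, induced by a POR. -/
lemma IsPOR.exists_map {A : V → H →L[ℂ] H} (hA : G.IsPOR A) :
    ∃ T : G.SSys →ₗ[ℂ] (H →L[ℂ] H), (∀ x, T (G.sGen x) = A x) ∧ T G.sOne = 1 := by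
  classical
  have hker : G.edgeKernel ≤ LinearMap.ker (G.edgeMap A) := by
    intro u hu
    rw [LinearMap.mem_ker, edgeMap_apply, hA.sum_eq_zero hu, smul_zero]
  refine ⟨G.edgeKernel.liftQ _ hker, fun x => ?_, ?_⟩
  · obtain ⟨e, he, hx⟩ := G.covers x
    rw [G.sGen_eq ⟨e, he⟩ ⟨x, hx⟩, map_smul, Submodule.mkQ_apply, Submodule.liftQ_apply,
      edgeMap_apply, smul_inv_smul₀ G.card_edges_ne_zero, Finset.sum_eq_single ⟨e, he⟩,
      Finset.sum_eq_single ⟨x, hx⟩]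
    · simp [edgeDelta]
    · intro y _ hy; simp [edgeDelta, hy]
    · simp
    · intro f _ hf
      simp [edgeDelta, hf]
    · simp
  · exact G.edgeMap_one hA.sum_eq

theorem isDilating_of_isCompleteOrderIso
    (h : IsCompleteOrderIso G.sCone G.tCone G.canonicalMap) : G.IsDilating := by
  intro H _ _ _ A hA
  obtain ⟨-, Ψ, hΨ, -, hcp⟩ := h
  have hΨ' : ∀ s, Ψ (G.canonicalMap s) = s := fun s => LinearMap.congr_fun hΨ s
  obtain ⟨T, hT, hT1⟩ := hA.exists_map
  have hφ : G.IsUCP (T ∘ₗ Ψ) := by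
    refine ⟨?_, fun n M hM => ?_⟩
    · rw [LinearMap.comp_apply, ← canonicalMap_sOne, hΨ', hT1]
    · refine G.map_mem_matPos_of_mem_sCone (fun x => ?_) hT1 (hcp n M hM)
      rw [hT x]
      exact CStarAlgebra.nonneg_iff_exists_star_mul_self.1
        ((ContinuousLinearMap.nonneg_iff_isPositive _).2 (hA.pos x))
  convert hφ.isDilatablePOR using 2 with x
  rw [← canonicalMap_sGen, LinearMap.comp_apply, hΨ', hT]

/-- In a dilating scenario, unital maps on `S_G` that are positive on the generators factor
through `T_G`. -/
lemma IsDilating.exists_isUCP (hG : G.IsDilating) {T : G.SSys →ₗ[ℂ] (H →L[ℂ] H)}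
    (hT : ∀ x, (T (G.sGen x)).IsPositive) (hT1 : T G.sOne = 1) :
    ∃ φ : G.TSys →ₗ[ℂ] (H →L[ℂ] H), G.IsUCP φ ∧ φ ∘ₗ G.canonicalMap = T := by
  have hA : G.IsPOR fun x => T (G.sGen x) :=
    ⟨hT, fun e he => by rw [← map_sum, G.sum_sGen he, hT1]⟩
  obtain ⟨φ, hφ, hφA⟩ := (hG H _ hA).exists_isUCP
  refine ⟨φ, hφ, SSys_hom_ext fun x => ?_⟩
  rw [LinearMap.comp_apply, canonicalMap_sGen, hφA]

/-- The functional on `S_G` defined by a probabilistic model. -/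
lemma exists_functional_of_mem_probModels {p : V → ℝ} (hp : p ∈ G.probModels) :
    ∃ τ : G.SSys →ₗ[ℂ] ℂ, (∀ x, τ (G.sGen x) = p x) ∧ τ G.sOne = 1 ∧
      ∀ u, τ (G.edgeKernel.mkQ u) = (G.edges.card : ℂ)⁻¹ * G.pairing p u := by
  let τ : G.SSys →ₗ[ℂ] ℂ := G.edgeKernel.liftQ ((G.edges.card : ℂ)⁻¹ • G.pairing p) (by
    intro u hu
    rw [LinearMap.mem_ker, LinearMap.smul_apply, (mem_edgeKernel G).1 hu p hp, smul_zero])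
  have hτ : ∀ x, τ (G.sGen x) = p x := by
    intro x
    obtain ⟨e, he, hx⟩ := G.covers x
    rw [G.sGen_eq ⟨e, he⟩ ⟨x, hx⟩, map_smul]
    change (G.edges.card : ℂ) • (G.edges.card : ℂ)⁻¹ • G.pairing p _ = _
    rw [smul_inv_smul₀ G.card_edges_ne_zero, pairing_edgeDelta]
  refine ⟨τ, hτ, ?_, fun u => rfl⟩
  obtain ⟨e, he⟩ := G.edges_nonempty
  rw [← G.sum_sGen he, map_sum, Finset.sum_congr rfl fun x _ => hτ x, ← Complex.ofReal_sum,
    hp.2 e he, Complex.ofReal_one]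

/-- The scalar POR defined by a probabilistic model. -/
lemma exists_scalar_map (H : Type u) [NormedAddCommGroup H] [InnerProductSpace ℂ H]
    [CompleteSpace H] {p : V → ℝ} (hp : p ∈ G.probModels) :
    ∃ T : G.SSys →ₗ[ℂ] (H →L[ℂ] H), (∀ x, (T (G.sGen x)).IsPositive) ∧ T G.sOne = 1 ∧
      ∀ u, T (G.edgeKernel.mkQ u) = ((G.edges.card : ℂ)⁻¹ * G.pairing p u) • 1 := by
  obtain ⟨τ, hτ, hτ1, hτu⟩ := exists_functional_of_mem_probModels hp
  refine ⟨τ.smulRight 1, fun x => ?_, ?_, fun u => ?_⟩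
  · rw [LinearMap.smulRight_apply, hτ, ← ContinuousLinearMap.nonneg_iff_isPositive,
      Complex.coe_smul]
    exact smul_nonneg (hp.1 x).1 zero_le_one
  · rw [LinearMap.smulRight_apply, hτ1, one_smul]
  · rw [LinearMap.smulRight_apply, hτu]

lemma IsDilating.canonicalMap_injective (hG : G.IsDilating) :
    Function.Injective G.canonicalMap := by
  rw [← LinearMap.ker_eq_bot, LinearMap.ker_eq_bot']
  intro s hs
  obtain ⟨u, rfl⟩ := Submodule.mkQ_surjective _ s
  rw [Submodule.mkQ_apply, Submodule.Quotient.mk_eq_zero, mem_edgeKernel]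
  intro p hp
  obtain ⟨T, hT, hT1, hTu⟩ := exists_scalar_map (EuclideanSpace ℂ PUnit.{u + 1}) hp
  obtain ⟨φ, -, rfl⟩ := hG.exists_isUCP hT hT1
  have h := hTu u
  rw [LinearMap.comp_apply, hs, map_zero] at h
  have h' := (smul_eq_zero.1 h.symm).resolve_right one_ne_zero
  simpa [G.card_edges_ne_zero] using h'

open scoped ComplexOrder

lemma IsDilating.sum_inner_nonneg_of_unital (hG : G.IsDilating) {T : G.SSys →ₗ[ℂ] (H →L[ℂ] H)}
    (hT : ∀ x, (T (G.sGen x)).IsPositive) (hT1 : T G.sOne = 1) {n : ℕ}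
    {U : Matrix (Fin n) (Fin n) G.SSys} (hU : U.map G.canonicalMap ∈ G.tCone n)
    (ξ : Fin n → H) : 0 ≤ ∑ i, ∑ j, ⟪ξ i, T (U i j) (ξ j)⟫_ℂ := by
  obtain ⟨φ, hφ, rfl⟩ := hG.exists_isUCP hT hT1
  exact sum_inner_nonneg_of_mem_matPos (hφ.2 n _ hU) ξ

lemma IsDilating.sum_inner_nonneg_of_isStrictlyPositive (hG : G.IsDilating)
    {T : G.SSys →ₗ[ℂ] (H →L[ℂ] H)}
    (hT : ∀ x, (T (G.sGen x)).IsPositive) (hT1 : IsStrictlyPositive (T G.sOne)) {n : ℕ}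
    {U : Matrix (Fin n) (Fin n) G.SSys} (hU : U.map G.canonicalMap ∈ G.tCone n)
    (ξ : Fin n → H) : 0 ≤ ∑ i, ∑ j, ⟪ξ i, T (U i j) (ξ j)⟫_ℂ := by
  obtain ⟨R, hR⟩ := hT1.isUnit_cfcSqrt
  have hRsa : star (R : H →L[ℂ] H) = R := by
    rw [hR]
    exact (IsSelfAdjoint.of_nonneg (CFC.sqrt_nonneg _)).star_eq
  have hRR : (R : H →L[ℂ] H) * R = T G.sOne := by
    rw [hR]
    exact CFC.sqrt_mul_sqrt_self _ hT1.nonneg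
  let S : H →L[ℂ] H := ↑R⁻¹
  have hSsa : star S = S := by
    have h : star R = R := Units.ext hRsa
    change ((star R⁻¹ : (H →L[ℂ] H)ˣ) : H →L[ℂ] H) = _
    rw [star_inv, h]
  have hcomp : ∀ X, compression S X = S * X * S := by
    intro X
    change star S * (X * S) = _
    rw [hSsa, mul_assoc]
  have key := hG.sum_inner_nonneg_of_unital (T := compression S ∘ₗ T)
    (fun x => (hT x).adjoint_conj S)
    (by
      rw [LinearMap.comp_apply, hcomp, ← hRR, ← mul_assoc, R.inv_mul, one_mul, R.mul_inv])
    hU (fun i => (R : H →L[ℂ] H) (ξ i))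
  have hSR : ∀ η : H, S ((R : H →L[ℂ] H) η) = η := by
    intro η
    rw [← mul_apply_eq_comp, R.inv_mul]
    rfl
  simpa only [LinearMap.comp_apply, inner_compression, hSR] using key

lemma IsDilating.re_sum_inner_nonneg (hG : G.IsDilating) (hG' : G.IsNontrivial)
    {T : G.SSys →ₗ[ℂ] (H →L[ℂ] H)} (hT : ∀ x, (T (G.sGen x)).IsPositive) {n : ℕ}
    {U : Matrix (Fin n) (Fin n) G.SSys} (hU : U.map G.canonicalMap ∈ G.tCone n)
    (ξ : Fin n → H) : 0 ≤ (∑ i, ∑ j, ⟪ξ i, T (U i j) (ξ j)⟫_ℂ).re := by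
  obtain ⟨p, hp⟩ := hG'
  obtain ⟨T₀, hT₀, hT₀1, -⟩ := exists_scalar_map H hp
  have hQ : 0 ≤ T G.sOne := by
    obtain ⟨e, he⟩ := G.edges_nonempty
    rw [← G.sum_sGen he, map_sum]
    exact Finset.sum_nonneg fun x _ => (ContinuousLinearMap.nonneg_iff_isPositive _).2 (hT x)
  have key : ∀ δ : ℝ, 0 < δ → 0 ≤ (∑ i, ∑ j, ⟪ξ i, T (U i j) (ξ j)⟫_ℂ).re +
      δ * (∑ i, ∑ j, ⟪ξ i, T₀ (U i j) (ξ j)⟫_ℂ).re := by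
    intro δ hδ
    have h := hG.sum_inner_nonneg_of_isStrictlyPositive (T := T + (δ : ℂ) • T₀) (fun x => ?_) ?_ hU ξ
    · have h' := (Complex.nonneg_iff.1 h).1
      simp only [LinearMap.add_apply, LinearMap.smul_apply, add_apply, smul_apply,
        inner_add_right, inner_smul_right, Finset.sum_add_distrib, ← Finset.mul_sum,
        Complex.add_re, Complex.re_ofReal_mul] at h'
      exact h'
    · rw [← ContinuousLinearMap.nonneg_iff_isPositive, LinearMap.add_apply, LinearMap.smul_apply,
        Complex.coe_smul]
      exact add_nonneg ((ContinuousLinearMap.nonneg_iff_isPositive _).2 (hT x))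
        (smul_nonneg hδ.le ((ContinuousLinearMap.nonneg_iff_isPositive _).2 (hT₀ x)))
    · rw [LinearMap.add_apply, LinearMap.smul_apply, hT₀1, Complex.coe_smul]
      refine IsStrictlyPositive.nonneg_add hQ ⟨smul_nonneg hδ.le zero_le_one, ?_⟩
      rw [← Algebra.algebraMap_eq_smul_one]
      exact (IsUnit.mk0 δ hδ.ne').map (algebraMap ℝ (H →L[ℂ] H))
  refine ge_of_tendsto (x := nhdsWithin (0 : ℝ) (Set.Ioi 0)) (f := fun δ : ℝ =>
    (∑ i, ∑ j, ⟪ξ i, T (U i j) (ξ j)⟫_ℂ).re +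
      δ * (∑ i, ∑ j, ⟪ξ i, T₀ (U i j) (ξ j)⟫_ℂ).re) ?_ ?_
  · refine Filter.Tendsto.mono_left ?_ nhdsWithin_le_nhds
    exact Continuous.tendsto' (by fun_prop) _ _ (by simp)
  · filter_upwards [self_mem_nhdsWithin] with δ hδ using key δ hδ

end EdgeMap

section Separation

variable {V : Type u} [Fintype V] {G : ContextualityScenario V} {n : ℕ}

lemma star_mem_edgeKernel {u : G.EdgeAlg} (hu : u ∈ G.edgeKernel) : star u ∈ G.edgeKernel := by
  rw [mem_edgeKernel] at hu ⊢
  intro p hp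
  have h : G.pairing p (star u) = star (G.pairing p u) := by
    change ∑ e : G.edges, ∑ x : e.1, (p x : ℂ) * star (u e x) =
      star (∑ e : G.edges, ∑ x : e.1, (p x : ℂ) * u e x)
    simp [star_sum]
  rw [h, hu p hp, star_zero]

variable (G n) in
/-- The cone of matrices over `⊕_e ℓ^∞_e` whose hermitian part agrees with a positive matrix
modulo the kernel. -/
def liftCone : PointedCone ℝ (Matrix (Fin n) (Fin n) G.EdgeAlg) where
  carrier := {N | ∃ P ∈ matPos G.EdgeAlg n, (N + N.conjTranspose).map G.edgeKernel.mkQ =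
    P.map G.edgeKernel.mkQ}
  add_mem' := by
    rintro M N ⟨P, hP, hMP⟩ ⟨Q, hQ, hNQ⟩
    refine ⟨P + Q, add_mem_matPos hP hQ, ?_⟩
    rw [Matrix.conjTranspose_add, add_add_add_comm, Matrix.map_add _ (map_add _), hMP, hNQ,
      ← Matrix.map_add _ (map_add _)]
  zero_mem' := ⟨0, zero_mem_matPos, by simp⟩
  smul_mem' := by
    rintro c N ⟨P, hP, hNP⟩
    refine ⟨((c : ℝ) : ℂ) • P, smul_mem_matPos c.2 hP, ?_⟩
    have h : c • N = ((c : ℝ) : ℂ) • N := rfl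
    rw [h, Matrix.conjTranspose_smul, Complex.star_def, Complex.conj_ofReal, ← smul_add,
      Matrix.map_smul _ _ (fun u => map_smul _ _ u), Matrix.map_smul _ _ (fun u => map_smul _ _ u),
      hNP]

lemma mem_liftCone_of_mem_matPos {N : Matrix (Fin n) (Fin n) G.EdgeAlg}
    (hN : N ∈ matPos G.EdgeAlg n) : N ∈ G.liftCone n :=
  ⟨N + N, add_mem_matPos hN hN, by rw [isHermitian_of_mem_matPos hN]⟩

lemma mem_liftCone_of_add_eq_zero {N : Matrix (Fin n) (Fin n) G.EdgeAlg}
    (hN : N + N.conjTranspose = 0) : N ∈ G.liftCone n :=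
  ⟨0, zero_mem_matPos, by rw [hN]⟩

lemma mem_liftCone_of_mem_edgeKernel {N : Matrix (Fin n) (Fin n) G.EdgeAlg}
    (hN : ∀ i j, N i j ∈ G.edgeKernel) : N ∈ G.liftCone n := by
  refine ⟨0, zero_mem_matPos, Matrix.ext fun i j => ?_⟩
  simp only [Matrix.map_apply, Matrix.zero_apply, map_zero]
  exact (Submodule.Quotient.mk_eq_zero _).2
    (add_mem (hN i j) (star_mem_edgeKernel (hN j i)))

open scoped ComplexOrder in
/-- A real functional that is nonnegative on `liftCone` is given by a map `T : S_G → B(H)`,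
positive on the generators, and vectors of `H`. -/
lemma exists_map_of_nonneg_liftCone (g : Module.Dual ℝ (Matrix (Fin n) (Fin n) G.EdgeAlg))
    (hg : ∀ N ∈ G.liftCone n, 0 ≤ g N) :
    ∃ (H : Type u) (_ : NormedAddCommGroup H) (_ : InnerProductSpace ℂ H) (_ : CompleteSpace H)
      (b : Fin n → H) (T : G.SSys →ₗ[ℂ] (H →L[ℂ] H)), (∀ x, (T (G.sGen x)).IsPositive) ∧
      ∀ N : Matrix (Fin n) (Fin n) G.EdgeAlg,
        (∑ i, ∑ j, ⟪b i, T (G.edgeKernel.mkQ (N i j)) (b j)⟫_ℂ).re = g N := by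
  classical
  let f : Module.Dual ℂ (Matrix (Fin n) (Fin n) G.EdgeAlg) := Module.Dual.extendRCLike g
  have hf : ∀ N, f N = g N - Complex.I * g (Complex.I • N) := fun N =>
    Module.Dual.extendRCLike_apply g N
  have hg0 : ∀ N, N ∈ G.liftCone n → -N ∈ G.liftCone n → g N = 0 := fun N h1 h2 =>
    le_antisymm (by simpa using hg _ h2) (hg _ h1)
  have hker : ∀ N : Matrix (Fin n) (Fin n) G.EdgeAlg, (∀ i j, N i j ∈ G.edgeKernel) →
      f N = 0 := by
    have h : ∀ N : Matrix (Fin n) (Fin n) G.EdgeAlg, (∀ i j, N i j ∈ G.edgeKernel) →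
        g N = 0 := fun N hN => hg0 N (mem_liftCone_of_mem_edgeKernel hN)
      (mem_liftCone_of_mem_edgeKernel fun i j => neg_mem (hN i j))
    intro N hN
    rw [hf, h N hN, h (Complex.I • N) fun i j => Submodule.smul_mem _ _ (hN i j)]
    simp
  have hpos : ∀ N ∈ matPos G.EdgeAlg n, 0 ≤ f N := by
    intro N hN
    have hskew : (Complex.I • N) + (Complex.I • N).conjTranspose = 0 := by
      rw [Matrix.conjTranspose_smul, isHermitian_of_mem_matPos hN]
      simp
    have hI : g (Complex.I • N) = 0 := by
      refine hg0 _ (mem_liftCone_of_add_eq_zero hskew) (mem_liftCone_of_add_eq_zero ?_)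
      rw [Matrix.conjTranspose_neg, ← neg_add, hskew, neg_zero]
    rw [hf, hI]
    simpa using hg N (mem_liftCone_of_mem_matPos hN)
  let b := (EuclideanSpace.basisFun (ULift.{u} (Fin n)) ℂ).reindex Equiv.ulift
  let E := EuclideanSpace ℂ (ULift.{u} (Fin n))
  let L : G.EdgeAlg →ₗ[ℂ] (E →L[ℂ] E) := ∑ i, ∑ j,
    (f ∘ₗ Matrix.singleLinearMap ℂ i j).smulRight (InnerProductSpace.rankOne ℂ (b i) (b j))
  have hL : ∀ u (ξ η : E), ⟪ξ, L u η⟫_ℂ =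
      ∑ i, ∑ j, f (Matrix.single i j u) * (⟪b j, η⟫_ℂ * ⟪ξ, b i⟫_ℂ) := by
    intro u ξ η
    simp [L]
  have hLker : G.edgeKernel ≤ LinearMap.ker L := by
    intro u hu
    rw [LinearMap.mem_ker]
    ext η : 1
    refine ext_inner_left ℂ fun ξ => ?_
    rw [hL]
    simp only [zero_apply, inner_zero_right]
    refine Finset.sum_eq_zero fun i _ => Finset.sum_eq_zero fun j _ => ?_
    rw [hker, zero_mul]
    intro k l
    rw [Matrix.single_apply]
    split_ifs
    exacts [hu, zero_mem _]
  have hsum : ∀ N : Matrix (Fin n) (Fin n) G.EdgeAlg,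
      ∑ i, ∑ j, f (Matrix.single i j (N i j)) = f N := by
    intro N
    conv_rhs => rw [Matrix.matrix_eq_sum_single N]
    simp only [map_sum]
  refine ⟨E, inferInstance, inferInstance, inferInstance, b, G.edgeKernel.liftQ L hLker,
    fun x => ?_, fun N => ?_⟩
  · obtain ⟨e, he, hx⟩ := G.covers x
    set d := G.edgeDelta ⟨e, he⟩ ⟨x, hx⟩ with hd
    have hdd : ∀ s t : ℂ, star (s • d) * (t • d) = (star s * t) • d := by
      intro s t
      have h : star d * d = d := by
        ext f y
        by_cases hf : f = ⟨e, he⟩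
        · subst hf
          by_cases hy : y = ⟨x, hx⟩
          · subst hy; simp [hd, edgeDelta]
          · simp [hd, edgeDelta, hy]
        · simp [hd, edgeDelta, hf]
      rw [star_smul, smul_mul_smul_comm, h]
    have hLd : (L d).IsPositive := by
      rw [ContinuousLinearMap.isPositive_iff_complex]
      intro ξ
      have h0 := hpos _ (vecMul_mem_matPos fun i => ⟪b i, ξ⟫_ℂ • d)
      rw [← hsum] at h0
      have h1 : ∑ i, ∑ j, f (Matrix.single i j (Matrix.of (fun i j =>
          star (⟪b i, ξ⟫_ℂ • d) * (⟪b j, ξ⟫_ℂ • d)) i j)) = ⟪ξ, L d ξ⟫_ℂ := by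
        rw [hL]
        refine Finset.sum_congr rfl fun i _ => Finset.sum_congr rfl fun j _ => ?_
        rw [Matrix.of_apply, hdd, ← Matrix.smul_single, map_smul, smul_eq_mul, Complex.star_def,
          inner_conj_symm]
        ring
      rw [h1] at h0
      obtain ⟨hre, him⟩ := Complex.nonneg_iff.1 h0
      rw [← inner_conj_symm (L d ξ)]
      generalize ⟪ξ, L d ξ⟫_ℂ = z at hre him
      exact ⟨Complex.ext (by simp) (by simp [← him]), by simpa using hre⟩
    rw [G.sGen_eq ⟨e, he⟩ ⟨x, hx⟩, map_smul, Submodule.mkQ_apply, Submodule.liftQ_apply,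
      ← ContinuousLinearMap.nonneg_iff_isPositive, ← Complex.ofReal_natCast, Complex.coe_smul]
    exact smul_nonneg (Nat.cast_nonneg _) ((ContinuousLinearMap.nonneg_iff_isPositive _).2 hLd)
  · have hfre : (f N).re = g N := Module.Dual.re_extendRCLike_apply (𝕜 := ℂ) g N
    rw [← hfre, ← hsum]
    congr 1
    refine Finset.sum_congr rfl fun i _ => Finset.sum_congr rfl fun j _ => ?_
    rw [Submodule.mkQ_apply, Submodule.liftQ_apply, hL, Finset.sum_eq_single i,
      Finset.sum_eq_single j]
    · simp [b.inner_eq_ite]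
    · intro k _ hk
      simp [b.inner_eq_ite, hk]
    · simp
    · intro k _ hk
      refine Finset.sum_eq_zero fun l _ => ?_
      simp [b.inner_eq_ite, hk.symm]
    · simp

instance : LocallyConvexSpace ℝ (Matrix (Fin n) (Fin n) G.EdgeAlg) :=
  inferInstanceAs (LocallyConvexSpace ℝ (Fin n → Fin n → G.EdgeAlg))

lemma IsDilating.mem_closure_liftCone (hG : G.IsDilating) (hG' : G.IsNontrivial)
    {N : Matrix (Fin n) (Fin n) G.EdgeAlg}
    (hN : (N.map G.edgeKernel.mkQ).map G.canonicalMap ∈ G.tCone n) :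
    N ∈ closure (G.liftCone n : Set (Matrix (Fin n) (Fin n) G.EdgeAlg)) := by
  by_contra hcl
  obtain ⟨g, hg, hgN⟩ := ProperCone.hyperplane_separation_point
    (Submodule.closure (G.liftCone n)) (x₀ := N) hcl
  obtain ⟨H, _, _, _, b, T, hT, hTg⟩ := exists_map_of_nonneg_liftCone (g : _ →ₗ[ℝ] ℝ)
    fun M hM => hg M (subset_closure hM)
  have h := hG.re_sum_inner_nonneg hG' hT hN b
  simp only [Matrix.map_apply] at h
  rw [hTg] at h
  exact absurd h (not_le.2 hgN)

theorem IsDilating.mem_sCone (hG : G.IsDilating) (hG' : G.IsNontrivial)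
    {U : Matrix (Fin n) (Fin n) G.SSys} (hU : U.map G.canonicalMap ∈ G.tCone n) :
    U ∈ G.sCone n := by
  obtain ⟨N, rfl⟩ : ∃ N : Matrix (Fin n) (Fin n) G.EdgeAlg, N.map G.edgeKernel.mkQ = U := by
    choose N hN using fun i j => Submodule.mkQ_surjective G.edgeKernel (U i j)
    exact ⟨Matrix.of N, Matrix.ext hN⟩
  have hherm : N.conjTranspose.map G.edgeKernel.mkQ = N.map G.edgeKernel.mkQ := by
    refine Matrix.ext fun i j => hG.canonicalMap_injective (Subtype.ext ?_)
    have h := congrFun (congrFun (isHermitian_of_mem_matPos hU) i) j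
    simp only [Matrix.conjTranspose_apply, Matrix.map_apply, canonicalMap_mkQ] at h ⊢
    rw [G.edgeMap_star fun x => (G.isStarProjection_projGen x).isSelfAdjoint.star_eq, h]
  intro ε hε
  have hcl := hG.mem_closure_liftCone hG' hU
  have hev : ∀ᶠ N' in nhds N, (N - N') + (N - N').conjTranspose +
      Matrix.diagonal (fun _ => ((2 * ε : ℝ) : ℂ) • (1 : G.EdgeAlg)) ∈ matPos G.EdgeAlg n := by
    have ht : Filter.Tendsto (fun N' => N - N') (nhds N) (nhds 0) :=
      Continuous.tendsto' (by fun_prop) _ _ (sub_self N)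
    exact ht.eventually (eventually_add_conjTranspose_mem_matPos (by positivity))
  obtain ⟨N', hN', P, hP, hNP⟩ := mem_closure_iff_nhds.1 hcl _ hev
  refine ⟨((1 / 2 : ℝ) : ℂ) • (P + _), smul_mem_matPos (by norm_num) (add_mem_matPos hP hN'), ?_⟩
  refine Matrix.ext fun i j => ?_
  have h1 := congrFun (congrFun hNP i) j
  have h2 := congrFun (congrFun hherm i) j
  simp only [Matrix.map_apply, Matrix.add_apply, Matrix.smul_apply, Matrix.sub_apply,
    Matrix.conjTranspose_apply, map_add, map_smul, star_sub, map_sub] at h1 h2 ⊢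
  rw [← h1, h2]
  have h3 : G.edgeKernel.mkQ (Matrix.diagonal (fun _ => ((2 * ε : ℝ) : ℂ) • (1 : G.EdgeAlg)) i j) =
      (2 : ℂ) • Matrix.diagonal (fun _ => (ε : ℂ) • G.sOne) i j := by
    rw [Matrix.diagonal_apply, Matrix.diagonal_apply]
    split_ifs
    · rw [map_smul, smul_smul]
      push_cast
      rfl
    · simp
  rw [h3]
  push_cast
  module

theorem IsDilating.isCompleteOrderIso (hG : G.IsDilating) (hG' : G.IsNontrivial) :
    IsCompleteOrderIso G.sCone G.tCone G.canonicalMap := by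
  let Ψ := LinearEquiv.ofBijective G.canonicalMap
    ⟨hG.canonicalMap_injective, G.canonicalMap_surjective⟩
  have hΨ : ∀ t, G.canonicalMap (Ψ.symm t) = t := fun t => Ψ.apply_symm_apply t
  refine ⟨G.isCP_canonicalMap, Ψ.symm, LinearMap.ext Ψ.symm_apply_apply, LinearMap.ext hΨ,
    fun n M hM => hG.mem_sCone hG' ?_⟩
  convert hM using 1
  exact Matrix.ext fun i j => hΨ (M i j)

end Separation

end ContextualityScenario

end

theorem mainTheorem7 {V : Type u} [Fintype V] (G : ContextualityScenario V)
    (hG : G.IsNontrivial) :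
    (G.IsDilating ↔
      ContextualityScenario.IsCompleteOrderIso G.sCone G.tCone G.canonicalMap) ∧
    (∀ (H : Type u) [NormedAddCommGroup H] [InnerProductSpace ℂ H] [CompleteSpace H],
      (∀ φ : G.TSys →ₗ[ℂ] (H →L[ℂ] H), G.IsUCP φ →
        G.IsDilatablePOR (fun x => φ (G.tGen x))) ∧
      (∀ A : V → H →L[ℂ] H, G.IsDilatablePOR A →
        ∃! φ : G.TSys →ₗ[ℂ] (H →L[ℂ] H), G.IsUCP φ ∧ ∀ x, φ (G.tGen x) = A x)) := by
  refine ⟨⟨fun h => h.isCompleteOrderIso hG,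
    ContextualityScenario.isDilating_of_isCompleteOrderIso⟩, fun H _ _ _ =>
    ⟨fun φ hφ => hφ.isDilatablePOR, fun A hA => ?_⟩⟩
  obtain ⟨φ, hφ, hφA⟩ := hA.exists_isUCP
  exact ⟨φ, ⟨hφ, hφA⟩, fun ψ hψ =>
    ContextualityScenario.TSys_hom_ext fun x => (hψ.2 x).trans (hφA x).symm⟩
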